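/- Let $1<\alpha\le 2$, $|\theta|\le\min\{\alpha,2-\alpha\}$ and $f\in C^1(\mathbb{R})$. Let $D^\alpha_\theta$ be the Riesz–Feller operator acting on functions $g\in C^2_b(\mathbb{R})$: for $\alpha=2$ (so $\theta=0$), $D^2_0 g=g''$, and for $1<\alpha<2$, $$D^\alpha_\theta g(x)=c_1\int_0^\infty\frac{g(x+\xi)-g(x)-g'(x)\xi}{\xi^{1+\alpha}}\,d\xi+c_2\int_0^\infty\frac{g(x-\xi)-g(x)+g'(x)\xi}{\xi^{1+\alpha}}\,d\xi,$$ $$c_1=\frac{\Gamma(1+\alpha)\sin((\alpha+\theta)\frac{\pi}{2})}{\pi},\qquad c_2=\frac{\Gamma(1+\alpha)\sin((\alpha-\theta)\frac{\pi}{2})}{\pi}.$$ For $T>0$ call $(u,v)$ a sub- /supersolution pair on $[0,T]$ if $u,v\in C_b(\mathbb{R}\times[0,T])$, $u,v\in C^2_b(\mathbb{R}\times(t_0,T])$ for all $t_0\in(0,T)$, and $$\frac{\partial u}{\partial t}\le D^\alpha_\theta u+f(u),\qquad \frac{\partial v}{\partial t}\ge D^\alpha_\theta v+f(v)\qquad\text{in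 }\mathbb{R}\times(0,T],$$ where the operator $D^\alpha_\theta$ acts in the variable $x$ and the time derivative at $t=T$ is one-sided. (Here $C_b$ denotes bounded continuous functions and $C^2_b$ twice continuously differentiable functions that are bounded together with all their partial derivatives of order at most two.) Then the following hold. (i) For every $T>0$ and every such pair: if $v(\cdot,0)\ge u(\cdot,0)$ on $\mathbb{R}$, then $v(x,t)\ge u(x,t)$ for all $(x,t)\in\mathbb{R}\times(0,T]$. (ii) For every $T>0$ and every such pair: if $v(\cdot,0)\ge u(\cdot,0)$ on $\mathbb{R}$ and $v(\cdot,0)\not\equiv u(\cdot,0)$, then $v(x,t)>u(x,t)$ for all $(x,t)\in\mathbb{R}\times(0,T]$. (iii) For every $R$ there exists a positive continuous function $\eta:[0,\infty)\times(0,\infty)\to(0,\infty)$, depending only on $\alpha,\theta,f,R$, such that for every $T>0$ and every such pair with $|u|,|v|\le R$ on $\mathbb{R}\times[0,T]$ and $v(\cdot,0)\ge u(\cdot,0)$ on $\mathbb{R}$, $$v(x,t)-u(x,t)\ \ge\ \eta(|x|,t)\int_0^1\big(v(y,0)-u(y,0)\big)\,dy\qquad\text{for all }(x,t)\in\mathbb{R}\times(0,T).$$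 -/

import Mathlib

open Set

noncomputable section

/-- The weight `c₁` of the jumps to the right in the singular integral representation of the
Riesz-Feller operator of order `α` and skewness `θ`. -/
def rieszFellerC1 (α θ : ℝ) : ℝ :=
  Real.Gamma (1 + α) * Real.sin ((α + θ) * (Real.pi / 2)) / Real.pi

/-- The weight `c₂` of the jumps to the left in the singular integral representation of the
Riesz-Feller operator of order `α` and skewness `θ`. -/
def rieszFellerC2 (α θ : ℝ) : ℝ :=
  Real.Gamma (1 + α) * Real.sin ((α - θ) * (Real.pi / 2)) / Real.pi

/-- The Riesz-Feller operator `D^α_θ` with `1 < α ≤ 2` and `|θ| ≤ min {α, 2 - α}`, extended to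
twice continuously differentiable functions with bounded derivatives. For `α = 2` (hence `θ = 0`)
it is the second derivative; for `1 < α < 2` it is the singular integral operator which, on
Schwartz functions and with the Fourier transform `∫ e^{iξx} g(x) dx`, is the Fourier multiplier
operator with symbol `- |ξ|^α exp (i sgn(ξ) θ π / 2)`. -/
def rieszFeller (α θ : ℝ) (g : ℝ → ℝ) (x : ℝ) : ℝ :=
  if α = 2 then iteratedDeriv 2 g x
  else
    rieszFellerC1 α θ *
        (∫ ξ in Ioi (0 : ℝ), (g (x + ξ) - g x - deriv g x * ξ) / ξ ^ (1 + α)) +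
      rieszFellerC2 α θ *
        (∫ ξ in Ioi (0 : ℝ), (g (x - ξ) - g x + deriv g x * ξ) / ξ ^ (1 + α))

/-- `w ∈ C_b(S)`: the function `(x, t) ↦ w x t` is continuous and bounded on `S`. -/
def MemCb (w : ℝ → ℝ → ℝ) (S : Set (ℝ × ℝ)) : Prop :=
  ContinuousOn (Function.uncurry w) S ∧ ∃ C : ℝ, ∀ p ∈ S, |w p.1 p.2| ≤ C

/-- `w ∈ C²_b(S)`: the function `(x, t) ↦ w x t` is twice continuously differentiable on `S`
(with one-sided derivatives at boundary points which belong to `S`), and it is bounded on `S`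
together with its derivatives of order one and two. -/
def MemC2b (w : ℝ → ℝ → ℝ) (S : Set (ℝ × ℝ)) : Prop :=
  ContDiffOn ℝ 2 (Function.uncurry w) S ∧
    ∀ k : ℕ, k ≤ 2 →
      ∃ C : ℝ, ∀ p ∈ S, ‖iteratedFDerivWithin ℝ k (Function.uncurry w) S p‖ ≤ C

/-- `w ∈ C_b(ℝ × [0, T]) ∩ C²_b(ℝ × (t₀, T])` for all `t₀ ∈ (0, T)`. -/
def IsAdmissible (T : ℝ) (w : ℝ → ℝ → ℝ) : Prop :=
  MemCb w (univ ×ˢ Icc 0 T) ∧ ∀ t₀ ∈ Ioo 0 T, MemC2b w (univ ×ˢ Ioc t₀ T)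

/-- `u_t ≤ D^α_θ u + f(u)` in `ℝ × (0, T]`; at `t = T` the time derivative is one-sided. -/
def IsSubsolution (α θ : ℝ) (f : ℝ → ℝ) (T : ℝ) (u : ℝ → ℝ → ℝ) : Prop :=
  ∀ x : ℝ, ∀ t ∈ Ioc 0 T,
    derivWithin (fun s => u x s) (Ioc 0 T) t ≤ rieszFeller α θ (fun y => u y t) x + f (u x t)

/-- `v_t ≥ D^α_θ v + f(v)` in `ℝ × (0, T]`; at `t = T` the time derivative is one-sided. -/
def IsSupersolution (α θ : ℝ) (f : ℝ → ℝ) (T : ℝ) (v : ℝ → ℝ → ℝ) : Prop :=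
  ∀ x : ℝ, ∀ t ∈ Ioc 0 T,
    rieszFeller α θ (fun y => v y t) x + f (v x t) ≤ derivWithin (fun s => v x s) (Ioc 0 T) t

end

noncomputable section

open MeasureTheory Filter Topology Real
open scoped FourierTransform ComplexConjugate

/-! ### The Riesz-Feller operator on bounded functions of class `C²` -/

/-! Write `w = v - u`, and let `K` be a Lipschitz constant of `f` on an interval containing the
values of `u` and `v`. Since `D` is linear, `w_t ≥ D w - K |w|`, and the nonlinearity plays no
further role.

Part (i) is a maximum principle (`nonneg_of_supersolution`). If `w` were negative somewhere,
`e^{-(K+1)t} w + ε √(1+x²)` would attain a negative minimum at some time `t > 0`. There the time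
derivative is at most `0`, while `D` of the unpenalised function is at least `-ε C` with `C`
depending only on `α` and `θ` (`exists_rieszFeller_ge_of_isMin`). For small `ε` this is
contradictory.

For (ii) and (iii), `w ≥ 0` now gives `w_t ≥ D w - K w`, so `w` can be compared with `e^{-Kt} S`,
where `S_t = D S` and `S` starts from a smooth compactly supported function below `w(·, 0)`. Such
`S` are built by Fourier transform: `D` is a multiplier with symbol `a k^α` for `k ≥ 0`, conjugate
for `k < 0`, with `Re a < 0` (`exists_rieszFeller_symbol`). Approximating `w(·, 0)` from below on
unit intervals yields `w(x,t) ≥ e^{-Kt} ∫_c^{c+1} G(x-y,t) w(y,0) dy`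
(`IsNonnegSupersolution.kernel_integral_le`), where `G` is the kernel of the evolution.

It remains to see that `G > 0` (`stableKernel_pos`). For `α = 2` it is a Gaussian. For `α < 2`, the
comparison principle gives `G ≥ 0`. At a zero of `G` the time derivative vanishes, hence so does `D
G`, which is there an integral of nonnegative increments; so `G(·, t)` vanishes on an interval. But
`G(·, t)` extends to an entire function and is not identically zero. Part (ii) follows at once, and
(iii) holds with `η` equal to `e^{-Kt}` times a minimum of `G` over a compact interval. -/

/-- Bounded real functions of class `C²`. -/
def BddC2 (g : ℝ → ℝ) : Prop := ContDiff ℝ 2 g ∧ ∃ B : ℝ, ∀ x, |g x| ≤ B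

lemma BddC2.differentiable {g : ℝ → ℝ} (hg : BddC2 g) : Differentiable ℝ g :=
  hg.1.differentiable (by norm_num)

lemma BddC2.sub {g h : ℝ → ℝ} (hg : BddC2 g) (hh : BddC2 h) : BddC2 (fun x => g x - h x) := by
  obtain ⟨B, hB⟩ := hg.2
  obtain ⟨C, hC⟩ := hh.2
  exact ⟨hg.1.sub hh.1, B + C, fun x => (abs_sub _ _).trans (add_le_add (hB x) (hC x))⟩

lemma BddC2.const_mul {g : ℝ → ℝ} (hg : BddC2 g) (c : ℝ) : BddC2 (fun x => c * g x) := by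
  obtain ⟨B, hB⟩ := hg.2
  refine ⟨contDiff_const.mul hg.1, |c| * B, fun x => ?_⟩
  rw [abs_mul]
  exact mul_le_mul_of_nonneg_left (hB x) (abs_nonneg c)

lemma BddC2.comp_neg {g : ℝ → ℝ} (hg : BddC2 g) : BddC2 (fun x => g (-x)) := by
  obtain ⟨B, hB⟩ := hg.2
  exact ⟨hg.1.comp contDiff_neg, B, fun x => hB _⟩

section Weights

variable {α θ : ℝ}

lemma angle_bounds (hα : 1 < α) (hθ : |θ| ≤ min α (2 - α)) :
    (0 < (α + θ) * (π / 2) ∧ (α + θ) * (π / 2) ≤ π) ∧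
      (0 < (α - θ) * (π / 2) ∧ (α - θ) * (π / 2) ≤ π) := by
  have h := abs_le.1 (hθ.trans (min_le_right _ _))
  have hp := Real.pi_pos
  refine ⟨⟨by apply mul_pos <;> linarith, ?_⟩, ⟨by apply mul_pos <;> linarith, ?_⟩⟩ <;> nlinarith

lemma rieszFellerC1_nonneg (hα : 1 < α) (hθ : |θ| ≤ min α (2 - α)) : 0 ≤ rieszFellerC1 α θ := by
  have h := (angle_bounds hα hθ).1
  exact div_nonneg (mul_nonneg (Real.Gamma_pos_of_pos (by linarith)).le
    (Real.sin_nonneg_of_nonneg_of_le_pi h.1.le h.2)) Real.pi_pos.le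

lemma rieszFellerC2_nonneg (hα : 1 < α) (hθ : |θ| ≤ min α (2 - α)) : 0 ≤ rieszFellerC2 α θ := by
  have h := (angle_bounds hα hθ).2
  exact div_nonneg (mul_nonneg (Real.Gamma_pos_of_pos (by linarith)).le
    (Real.sin_nonneg_of_nonneg_of_le_pi h.1.le h.2)) Real.pi_pos.le

/-- In the extremal case `|θ| = 2 - α` one angle equals `π` and jumps occur on one side only. The
two angles add up to `απ < 2π`, so they cannot both equal `π`. -/
lemma rieszFellerC_pos (hα : 1 < α) (hα' : α < 2) (hθ : |θ| ≤ min α (2 - α)) :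
    0 < rieszFellerC1 α θ ∨ 0 < rieszFellerC2 α θ := by
  have h := angle_bounds hα hθ
  have hG : 0 < Real.Gamma (1 + α) := Real.Gamma_pos_of_pos (by linarith)
  have hp := Real.pi_pos
  by_cases h1 : (α + θ) * (π / 2) < π
  · exact Or.inl (div_pos (mul_pos hG (Real.sin_pos_of_pos_of_lt_pi h.1.1 h1)) hp)
  · refine Or.inr (div_pos (mul_pos hG (Real.sin_pos_of_pos_of_lt_pi h.2.1 ?_)) hp)
    nlinarith

end Weights

/-- The integrable majorant `min (ξ², ξ) / ξ^{1+α}` for the singular integrands. -/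
def jumpMajorant (α ξ : ℝ) : ℝ := min (ξ ^ 2) ξ / ξ ^ (1 + α)

lemma jumpMajorant_nonneg (α : ℝ) {ξ : ℝ} (hξ : 0 < ξ) : 0 ≤ jumpMajorant α ξ := by
  unfold jumpMajorant; positivity

lemma integrableOn_jumpMajorant {α : ℝ} (hα : 1 < α) (hα' : α < 2) :
    IntegrableOn (jumpMajorant α) (Ioi 0) := by
  rw [← Ioc_union_Ioi_eq_Ioi (zero_le_one' ℝ)]
  refine IntegrableOn.union ?_ ?_
  · have h := (intervalIntegral.intervalIntegrable_rpow' (a := 0) (b := 1)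
      (r := 1 - α) (by linarith)).1
    refine h.congr_fun (fun ξ hξ => ?_) measurableSet_Ioc
    have : ξ ^ 2 ≤ ξ := by nlinarith [hξ.1, hξ.2]
    simp only [jumpMajorant, min_eq_left this]
    rw [← Real.rpow_natCast, ← Real.rpow_sub hξ.1]
    congr 1; push_cast; ring
  · have h := integrableOn_Ioi_rpow_of_lt (a := -α) (by linarith) one_pos
    refine h.congr_fun (fun ξ hξ => ?_) measurableSet_Ioi
    have h1 : (1 : ℝ) < ξ := hξ
    have : ξ ≤ ξ ^ 2 := by nlinarith
    simp only [jumpMajorant, min_eq_right this]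
    rw [eq_div_iff (by positivity), ← Real.rpow_add (by linarith)]
    simp

/-- Taylor's formula on `[x, x+1]` gives the quadratic part, boundedness of `g` the linear one. The
constant may depend on `x`, because `BddC2` bounds only `g` and not its derivatives. -/
lemma BddC2.exists_incr_bound {g : ℝ → ℝ} (hg : BddC2 g) (x : ℝ) :
    ∃ C : ℝ, 0 ≤ C ∧ ∀ ξ, 0 < ξ → |g (x + ξ) - g x - deriv g x * ξ| ≤ C * min (ξ ^ 2) ξ := by
  obtain ⟨B, hB⟩ := hg.2
  have hx1 : x < x + 1 := by linarith
  obtain ⟨C, hC⟩ := exists_taylor_mean_remainder_bound (n := 1) hx1.le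
    (hg.1.contDiffOn (s := Icc x (x + 1)))
  have hB0 : 0 ≤ B := (abs_nonneg _).trans (hB 0)
  refine ⟨max C (2 * B + |deriv g x|), le_max_of_le_right (by positivity), fun ξ hξ => ?_⟩
  rcases le_total ξ 1 with h1 | h1
  · have h2 : ξ ^ 2 ≤ ξ := by nlinarith
    have := hC (x + ξ) ⟨by linarith, by linarith⟩
    rw [taylorWithinEval_succ, taylor_within_zero_eval, iteratedDerivWithin_one,
      (hg.differentiable x).derivWithin
        ((uniqueDiffOn_Icc hx1) x (left_mem_Icc.2 hx1.le))] at this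
    rw [min_eq_left h2]
    refine le_trans ?_ (mul_le_mul_of_nonneg_right (le_max_left _ _) (by positivity))
    simpa [mul_comm, sub_sub] using this
  · have h2 : ξ ≤ ξ ^ 2 := by nlinarith
    rw [min_eq_right h2]
    refine le_trans ?_ (mul_le_mul_of_nonneg_right (le_max_right _ _) (by positivity))
    have h3 := abs_sub (g (x + ξ) - g x) (deriv g x * ξ)
    have h4 := abs_sub (g (x + ξ)) (g x)
    rw [abs_mul, abs_of_pos hξ] at h3
    nlinarith [hB (x + ξ), hB x]

lemma BddC2.integrableOn_incr {α : ℝ} (hα : 1 < α) (hα' : α < 2) {g : ℝ → ℝ} (hg : BddC2 g)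
    (x : ℝ) :
    IntegrableOn (fun ξ => (g (x + ξ) - g x - deriv g x * ξ) / ξ ^ (1 + α)) (Ioi 0) := by
  obtain ⟨C, -, hC⟩ := hg.exists_incr_bound x
  refine Integrable.mono' ((integrableOn_jumpMajorant hα hα').const_mul C) ?_ ?_
  · have : Measurable g := hg.1.continuous.measurable
    exact Measurable.aestronglyMeasurable (by fun_prop)
  · filter_upwards [ae_restrict_mem measurableSet_Ioi] with ξ hξ
    have hp : (0 : ℝ) < ξ ^ (1 + α) := Real.rpow_pos_of_pos hξ _
    rw [Real.norm_eq_abs, abs_div, abs_of_pos hp, jumpMajorant, ← mul_div_assoc]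
    exact div_le_div_of_nonneg_right (hC ξ hξ) hp.le

lemma deriv_comp_neg_neg (g : ℝ → ℝ) (x : ℝ) : deriv (fun y => g (-y)) (-x) = -deriv g x := by
  rw [deriv_comp_neg, neg_neg]

lemma BddC2.integrableOn_incr' {α : ℝ} (hα : 1 < α) (hα' : α < 2) {g : ℝ → ℝ} (hg : BddC2 g)
    (x : ℝ) :
    IntegrableOn (fun ξ => (g (x - ξ) - g x + deriv g x * ξ) / ξ ^ (1 + α)) (Ioi 0) := by
  have h := hg.comp_neg.integrableOn_incr hα hα' (-x)
  simp only [deriv_comp_neg_neg, neg_add, neg_neg, neg_mul, sub_neg_eq_add] at h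
  exact h

lemma rieszFeller_two (θ : ℝ) (g : ℝ → ℝ) (x : ℝ) :
    rieszFeller 2 θ g x = iteratedDeriv 2 g x := if_pos rfl

lemma rieszFeller_sub {α θ : ℝ} (hα : 1 < α) (hα' : α ≤ 2) {g h : ℝ → ℝ} (hg : BddC2 g)
    (hh : BddC2 h) (x : ℝ) :
    rieszFeller α θ (fun y => g y - h y) x = rieszFeller α θ g x - rieszFeller α θ h x := by
  unfold rieszFeller
  split_ifs with h2
  · exact iteratedDeriv_fun_sub hg.1.contDiffAt hh.1.contDiffAt
  · have hlt := lt_of_le_of_ne hα' h2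
    have hd : deriv (fun y => g y - h y) x = deriv g x - deriv h x :=
      deriv_fun_sub (hg.differentiable x) (hh.differentiable x)
    have e1 : ∀ ξ : ℝ, (g (x + ξ) - h (x + ξ) - (g x - h x) - (deriv g x - deriv h x) * ξ) /
        ξ ^ (1 + α) = (g (x + ξ) - g x - deriv g x * ξ) / ξ ^ (1 + α) -
          (h (x + ξ) - h x - deriv h x * ξ) / ξ ^ (1 + α) := fun ξ => by
      rw [← sub_div]; congr 1; ring
    have e2 : ∀ ξ : ℝ, (g (x - ξ) - h (x - ξ) - (g x - h x) + (deriv g x - deriv h x) * ξ) /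
        ξ ^ (1 + α) = (g (x - ξ) - g x + deriv g x * ξ) / ξ ^ (1 + α) -
          (h (x - ξ) - h x + deriv h x * ξ) / ξ ^ (1 + α) := fun ξ => by
      rw [← sub_div]; congr 1; ring
    simp only [hd, e1, e2]
    rw [integral_sub (hg.integrableOn_incr hα hlt x) (hh.integrableOn_incr hα hlt x),
      integral_sub (hg.integrableOn_incr' hα hlt x) (hh.integrableOn_incr' hα hlt x)]
    ring

lemma rieszFeller_const_mul {α θ : ℝ} {g : ℝ → ℝ} (hg : BddC2 g) (c x : ℝ) :
    rieszFeller α θ (fun y => c * g y) x = c * rieszFeller α θ g x := by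
  unfold rieszFeller
  split_ifs with h2
  · exact iteratedDeriv_const_mul_field c g
  · have hd : deriv (fun y => c * g y) x = c * deriv g x := deriv_const_mul _ (hg.differentiable x)
    have e1 : ∀ ξ : ℝ, (c * g (x + ξ) - c * g x - c * deriv g x * ξ) / ξ ^ (1 + α) =
        c * ((g (x + ξ) - g x - deriv g x * ξ) / ξ ^ (1 + α)) := fun ξ => by ring
    have e2 : ∀ ξ : ℝ, (c * g (x - ξ) - c * g x + c * deriv g x * ξ) / ξ ^ (1 + α) =
        c * ((g (x - ξ) - g x + deriv g x * ξ) / ξ ^ (1 + α)) := fun ξ => by ring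
    simp only [hd, e1, e2]
    rw [integral_const_mul, integral_const_mul]
    ring

/-! ### The Riesz-Feller operator at minimum points -/

/-- The penalisation function `√(1 + x²)`. -/
def penalty (x : ℝ) : ℝ := √(1 + x ^ 2)

lemma continuous_penalty : Continuous penalty := by unfold penalty; fun_prop

lemma penalty_nonneg (x : ℝ) : 0 ≤ penalty x := Real.sqrt_nonneg _

lemma abs_le_penalty (x : ℝ) : |x| ≤ penalty x := Real.abs_le_sqrt (by linarith)

lemma hasDerivAt_penalty (x : ℝ) : HasDerivAt penalty (x / penalty x) x := by
  have h : HasDerivAt (fun y : ℝ => 1 + y ^ 2) (2 * x) x := by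
    simpa using (hasDerivAt_pow 2 x).const_add 1
  have h' := h.sqrt (by positivity)
  exact h'.congr_deriv (mul_div_mul_left _ _ two_ne_zero)

/-- The quadratic bound comes from the square root lying below its tangent, the linear one from
`penalty` being 1-Lipschitz. What matters is that the constant does not depend on `x`. -/
lemma penalty_incr_le (x ξ : ℝ) :
    penalty (x + ξ) - penalty x - x / penalty x * ξ ≤ 2 * min (ξ ^ 2) |ξ| := by
  have h1 : 1 ≤ penalty x := Real.one_le_sqrt.2 (by nlinarith [sq_nonneg x])
  have h0 : 0 < penalty x := by linarith
  have hs : penalty x ^ 2 = 1 + x ^ 2 := Real.sq_sqrt (by positivity)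
  have hs' : penalty (x + ξ) ^ 2 = 1 + (x + ξ) ^ 2 := Real.sq_sqrt (by positivity)
  have hax := abs_le_penalty x
  rw [mul_min_of_nonneg _ _ zero_le_two]
  refine le_min ?_ ?_
  · have : penalty (x + ξ) ≤ penalty x + (x * ξ + ξ ^ 2 / 2) / penalty x := by
      have := sq_nonneg (penalty (x + ξ) - penalty x)
      rw [← sub_le_iff_le_add', le_div_iff₀ h0]
      nlinarith
    have h2 : ξ ^ 2 / 2 / penalty x ≤ ξ ^ 2 / 2 := div_le_self (by positivity) h1
    rw [add_div] at this
    have h3 : x * ξ / penalty x = x / penalty x * ξ := by ring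
    nlinarith [sq_nonneg ξ]
  · have h2 : penalty (x + ξ) ≤ penalty x + |ξ| := by
      refine abs_le_of_sq_le_sq' ?_ (by positivity) |>.2
      have : x * ξ ≤ penalty x * |ξ| := by
        calc x * ξ ≤ |x * ξ| := le_abs_self _
          _ = |x| * |ξ| := abs_mul _ _
          _ ≤ _ := by gcongr
      nlinarith [sq_abs ξ]
    have h3 : |x / penalty x * ξ| ≤ |ξ| := by
      rw [abs_mul, abs_div, abs_of_pos h0]
      exact mul_le_of_le_one_left (abs_nonneg _) ((div_le_one h0).2 hax)
    linarith [neg_abs_le (x / penalty x * ξ)]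

/-- Were it negative, the second derivative test would make the minimum also a local maximum; `g`
would be locally constant with vanishing second derivative. -/
lemma iteratedDeriv_two_nonneg_of_isMin {g : ℝ → ℝ} (hg : ContDiff ℝ 2 g) {x : ℝ}
    (hmin : ∀ y, g x ≤ g y) : 0 ≤ iteratedDeriv 2 g x := by
  by_contra! hneg
  have hd : deriv g x = 0 := IsLocalMin.deriv_eq_zero (Eventually.of_forall hmin)
  rw [iteratedDeriv_succ, iteratedDeriv_one] at hneg
  have hmax := isLocalMax_of_deriv_deriv_neg hneg hd hg.continuous.continuousAt
  have heq : g =ᶠ[𝓝 x] fun _ => g x := by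
    filter_upwards [hmax] with y hy using le_antisymm hy (hmin y)
  have h2 : deriv g =ᶠ[𝓝 x] fun _ => 0 := by
    filter_upwards [heq.eventuallyEq_nhds] with y hy
    rw [hy.deriv_eq]; simp
  rw [h2.deriv_eq] at hneg
  simp at hneg

lemma incr_ge_of_isMin {g : ℝ → ℝ} (hg : Differentiable ℝ g) {ε x : ℝ} (hε : 0 ≤ ε)
    (hmin : ∀ y, g x + ε * penalty x ≤ g y + ε * penalty y) (ξ : ℝ) :
    -(ε * (2 * min (ξ ^ 2) |ξ|)) ≤ g (x + ξ) - g x - deriv g x * ξ := by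
  have hd : deriv g x + ε * (x / penalty x) = 0 := by
    have h1 : HasDerivAt (fun y => g y + ε * penalty y) (deriv g x + ε * (x / penalty x)) x :=
      (hg x).hasDerivAt.add ((hasDerivAt_penalty x).const_mul ε)
    exact IsLocalMin.hasDerivAt_eq_zero (Eventually.of_forall hmin) h1
  have h2 := mul_le_mul_of_nonneg_left (penalty_incr_le x ξ) hε
  have h3 : deriv g x = -(ε * (x / penalty x)) := by linarith
  rw [h3]
  nlinarith [hmin (x + ξ)]

/-- At the penalised minimum, `incr_ge_of_isMin` bounds the increments of `g` below by those of a
fixed integrable majorant times `-ε`. Hence `C` is uniform in `g`, `ε` and `x`, which lets `ε` be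
chosen after it. -/
lemma exists_rieszFeller_ge_of_isMin {α θ : ℝ} (hα : 1 < α) (hα' : α ≤ 2)
    (hθ : |θ| ≤ min α (2 - α)) :
    ∃ C : ℝ, 0 ≤ C ∧ ∀ (g : ℝ → ℝ) (ε x : ℝ), BddC2 g → 0 ≤ ε →
      (∀ y, g x + ε * penalty x ≤ g y + ε * penalty y) → -(ε * C) ≤ rieszFeller α θ g x := by
  rcases eq_or_lt_of_le hα' with rfl | hlt
  · refine ⟨4, by norm_num, fun g ε x hg hε hmin => ?_⟩
    rw [rieszFeller_two]
    -- Adding this parabola turns the lower bound on increments into a genuine minimum at `x`; its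
    -- second derivative `4 * ε` is the source of the constant `4`.
    have hk : ContDiff ℝ 2 (fun y : ℝ => 2 * ε * (y - x) ^ 2 - deriv g x * (y - x)) := by fun_prop
    have h1 := iteratedDeriv_two_nonneg_of_isMin (x := x) (hg.1.add hk) (fun y => by
      have := incr_ge_of_isMin hg.differentiable hε hmin (y - x)
      have h2 := min_le_left ((y - x) ^ 2) |y - x|
      have h3 := mul_le_mul_of_nonneg_left h2 hε
      simp only [add_sub_cancel] at this
      simp only [sub_self]
      nlinarith)
    rw [iteratedDeriv_fun_add hg.1.contDiffAt hk.contDiffAt] at h1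
    have h2 : iteratedDeriv 2 (fun y : ℝ => 2 * ε * (y - x) ^ 2 - deriv g x * (y - x)) x =
        4 * ε := by
      rw [iteratedDeriv_succ, iteratedDeriv_one]
      have : deriv (fun y : ℝ => 2 * ε * (y - x) ^ 2 - deriv g x * (y - x)) =
          fun y => 4 * ε * (y - x) - deriv g x := by
        ext y
        have h := (((hasDerivAt_id y).sub_const x).pow 2).const_mul (2 * ε) |>.sub
          (((hasDerivAt_id y).sub_const x).const_mul (deriv g x))
        refine HasDerivAt.deriv (h.congr_deriv ?_)
        simp
        ring
      rw [this]
      simp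
    linarith
  · set I : ℝ := ∫ ξ in Ioi (0 : ℝ), jumpMajorant α ξ with hI
    have hI0 : 0 ≤ I := setIntegral_nonneg measurableSet_Ioi
      fun ξ hξ => jumpMajorant_nonneg α hξ
    have h1 := rieszFellerC1_nonneg hα hθ
    have h2 := rieszFellerC2_nonneg hα hθ
    refine ⟨(rieszFellerC1 α θ + rieszFellerC2 α θ) * (2 * I), by positivity,
      fun g ε x hg hε hmin => ?_⟩
    have key : -(ε * (2 * I)) = ∫ ξ in Ioi (0 : ℝ), -(ε * 2) * jumpMajorant α ξ := by
      rw [integral_const_mul]; ring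
    have hq := (integrableOn_jumpMajorant hα hlt).const_mul (-(ε * 2))
    have hpt : ∀ a ξ : ℝ, ξ ∈ Ioi (0 : ℝ) → -(ε * (2 * min (ξ ^ 2) ξ)) ≤ a →
        -(ε * 2) * jumpMajorant α ξ ≤ a / ξ ^ (1 + α) := fun a ξ hξ ha => by
      have hp : (0 : ℝ) < ξ ^ (1 + α) := Real.rpow_pos_of_pos hξ _
      rw [jumpMajorant, ← mul_div_assoc]
      exact div_le_div_of_nonneg_right (le_of_eq_of_le (by ring) ha) hp.le
    have k1 : -(ε * (2 * I)) ≤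
        ∫ ξ in Ioi (0 : ℝ), (g (x + ξ) - g x - deriv g x * ξ) / ξ ^ (1 + α) := by
      rw [key]
      refine setIntegral_mono_on hq (hg.integrableOn_incr hα hlt x) measurableSet_Ioi
        fun ξ hξ => hpt _ ξ hξ ?_
      have := incr_ge_of_isMin hg.differentiable hε hmin ξ
      rwa [abs_of_pos hξ] at this
    have k2 : -(ε * (2 * I)) ≤
        ∫ ξ in Ioi (0 : ℝ), (g (x - ξ) - g x + deriv g x * ξ) / ξ ^ (1 + α) := by
      rw [key]
      refine setIntegral_mono_on hq (hg.integrableOn_incr' hα hlt x) measurableSet_Ioi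
        fun ξ hξ => hpt _ ξ hξ ?_
      have := incr_ge_of_isMin hg.differentiable hε hmin (-ξ)
      rw [abs_neg, abs_of_pos hξ, neg_sq] at this
      simpa [sub_eq_add_neg] using this
    rw [rieszFeller, if_neg hlt.ne]
    nlinarith [mul_le_mul_of_nonneg_left k1 h1, mul_le_mul_of_nonneg_left k2 h2]

/-! ### The comparison principle -/

lemma HasDerivWithinAt.nonpos_of_isMin_left {h : ℝ → ℝ} {h' T t : ℝ} (ht : t ∈ Ioc 0 T)
    (hh : HasDerivWithinAt h h' (Ioc 0 T) t) (hmin : ∀ s ∈ Ioc 0 T, h t ≤ h s) : h' ≤ 0 := by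
  have h1 : HasDerivWithinAt h h' (Ioo 0 t) t :=
    hh.mono fun s hs => ⟨hs.1, hs.2.le.trans ht.2⟩
  rw [hasDerivWithinAt_iff_tendsto_slope' (by simp)] at h1
  have : (𝓝[Ioo 0 t] t).NeBot := right_nhdsWithin_Ioo_neBot ht.1
  refine le_of_tendsto h1 ?_
  filter_upwards [self_mem_nhdsWithin] with s hs
  rw [slope_def_field]
  exact div_nonpos_of_nonneg_of_nonpos (by linarith [hmin s ⟨hs.1, hs.2.le.trans ht.2⟩])
    (by linarith [hs.2])

/-- Penalisation forces the minimum to be attained on the unbounded strip. The absolute value in the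
zero-order term allows use before any sign of `w` is known. -/
theorem nonneg_of_supersolution {α θ : ℝ} (hα : 1 < α) (hα' : α ≤ 2)
    (hθ : |θ| ≤ min α (2 - α)) {K T : ℝ} (hK : 0 ≤ K) {w : ℝ → ℝ → ℝ}
    (hc : ContinuousOn (Function.uncurry w) (univ ×ˢ Icc 0 T))
    (hb : ∃ B : ℝ, ∀ x, ∀ t ∈ Icc 0 T, |w x t| ≤ B) (h0 : ∀ x, 0 ≤ w x 0)
    (hC2 : ∀ t ∈ Ioc 0 T, BddC2 fun x => w x t)
    (hw : ∀ x, ∀ t ∈ Ioc 0 T, ∃ w', HasDerivWithinAt (fun s => w x s) w' (Ioc 0 T) t ∧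
      rieszFeller α θ (fun y => w y t) x - K * |w x t| ≤ w') :
    ∀ x, ∀ t ∈ Icc 0 T, 0 ≤ w x t := by
  intro x₁ t₁ ht₁
  by_contra! hneg
  obtain ⟨C, hC0, hC⟩ := exists_rieszFeller_ge_of_isMin hα hα' hθ
  obtain ⟨B, hB⟩ := hb
  -- The surplus `1` over `K` leaves a term `|W|` at the negative minimum: there the time derivative
  -- of `W` is at least `|W| - ε * C`.
  set L := K + 1 with hL
  set W : ℝ → ℝ → ℝ := fun x t => exp (-L * t) * w x t with hW
  have hWB : ∀ x, ∀ t ∈ Icc 0 T, -B ≤ W x t := fun x t ht => by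
    have h1 : exp (-L * t) ≤ 1 := Real.exp_le_one_iff.2 (by nlinarith [ht.1])
    have h2 : |W x t| ≤ B := by
      rw [hW, abs_mul, abs_of_pos (exp_pos _)]
      exact (mul_le_of_le_one_left (abs_nonneg _) h1).trans (hB x t ht)
    exact (abs_le.1 h2).1
  obtain ⟨δ, hδ⟩ : ∃ δ, δ = -W x₁ t₁ := ⟨_, rfl⟩
  have hδ0 : 0 < δ := by
    rw [hδ, neg_pos]; exact mul_neg_of_pos_of_neg (exp_pos _) hneg
  have hp1 := penalty_nonneg x₁
  -- Small enough that the penalty keeps the value at `(x₁, t₁)` below `-δ/2`, and that the error `ε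
  -- * C` stays strictly below `δ/2`.
  obtain ⟨ε, hε⟩ : ∃ ε, ε = δ / (2 * (C + penalty x₁ + 1)) := ⟨_, rfl⟩
  have hε0 : 0 < ε := by rw [hε]; positivity
  have hεe : ε * (C + penalty x₁ + 1) = δ / 2 := by rw [hε]; field_simp
  have hεC : ε * C < δ / 2 := by nlinarith [mul_nonneg hε0.le hp1]
  have hεp : ε * penalty x₁ ≤ δ / 2 := by nlinarith [mul_nonneg hε0.le hC0]
  set z : ℝ × ℝ → ℝ := fun p => W p.1 p.2 + ε * penalty p.1 with hz
  have hzc : ContinuousOn z (univ ×ˢ Icc 0 T) := by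
    have h1 : Continuous fun p : ℝ × ℝ => exp (-L * p.2) := by fun_prop
    have h2 : Continuous fun p : ℝ × ℝ => ε * penalty p.1 :=
      continuous_const.mul (continuous_penalty.comp continuous_fst)
    exact (h1.continuousOn.mul hc).add h2.continuousOn
  have hz1 : z (x₁, t₁) ≤ -(δ / 2) := by simp only [hz]; linarith
  -- For `|x| > M` the penalty exceeds `B`, so `z > 0`, and a minimum over the compact part is
  -- global.
  set M := max |x₁| (B / ε) with hM
  obtain ⟨⟨x₀, t₀⟩, hmem, hmin'⟩ := (isCompact_Icc.prod isCompact_Icc).exists_isMinOn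
    (s := Icc (-M) M ×ˢ Icc 0 T)
    ⟨(x₁, t₁), abs_le.1 (le_max_left |x₁| (B / ε)), ht₁⟩
    (hzc.mono (prod_mono (subset_univ _) le_rfl))
  have hmin₁ : z (x₀, t₀) ≤ z (x₁, t₁) :=
    hmin' (a := (x₁, t₁)) ⟨abs_le.1 (le_max_left |x₁| (B / ε)), ht₁⟩
  have hmin : ∀ x, ∀ t ∈ Icc 0 T, z (x₀, t₀) ≤ z (x, t) := fun x t ht => by
    rcases le_or_gt |x| M with h | h
    · exact hmin' (a := (x, t)) ⟨abs_le.1 h, ht⟩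
    · have h1 : B < penalty x * ε :=
        (div_lt_iff₀ hε0).1 (((le_max_right _ _).trans_lt h).trans_le (abs_le_penalty x))
      have h2 : 0 < z (x, t) := by
        simp only [hz]; nlinarith [hWB x t ht]
      linarith
  have hz0 : z (x₀, t₀) ≤ -(δ / 2) := hmin₁.trans hz1
  have hW0 : W x₀ t₀ ≤ -(δ / 2) := by
    have := mul_nonneg hε0.le (penalty_nonneg x₀)
    simp only [hz] at hz0; linarith
  have ht₀ : t₀ ∈ Icc 0 T := hmem.2
  have ht₀' : t₀ ∈ Ioc 0 T := by
    refine ⟨lt_of_le_of_ne ht₀.1 ?_, ht₀.2⟩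
    rintro rfl
    have : 0 ≤ W x₀ 0 := mul_nonneg (exp_pos _).le (h0 x₀)
    linarith
  have hD : -(ε * C) ≤ rieszFeller α θ (fun y => W y t₀) x₀ :=
    hC _ ε x₀ ((hC2 t₀ ht₀').const_mul _) hε0.le fun y => hmin y t₀ ht₀
  rw [show (fun y => W y t₀) = fun y => exp (-L * t₀) * w y t₀ from rfl,
    rieszFeller_const_mul (hC2 t₀ ht₀')] at hD
  obtain ⟨w', hw', hle⟩ := hw x₀ t₀ ht₀'
  have hder : HasDerivWithinAt (fun s => W x₀ s)
      (exp (-L * t₀) * (-L) * w x₀ t₀ + exp (-L * t₀) * w') (Ioc 0 T) t₀ := by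
    have h1 : HasDerivAt (fun s : ℝ => exp (-L * s)) (exp (-L * t₀) * (-L)) t₀ := by
      simpa using ((hasDerivAt_id t₀).const_mul (-L)).exp
    exact h1.hasDerivWithinAt.mul hw'
  have hnp := hder.nonpos_of_isMin_left ht₀' fun s hs => by
    have := hmin x₀ s ⟨hs.1.le, hs.2⟩
    simpa [hz] using this
  have hE := exp_pos (-L * t₀)
  have hwneg : w x₀ t₀ < 0 := by
    by_contra! h
    have : 0 ≤ W x₀ t₀ := mul_nonneg hE.le h
    linarith
  rw [abs_of_neg hwneg] at hle
  have h3 := mul_le_mul_of_nonneg_left hle hE.le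
  have h4 : W x₀ t₀ = exp (-L * t₀) * w x₀ t₀ := rfl
  rw [hL] at *
  nlinarith

/-! ### Fourier transforms and the symbol of the Riesz-Feller operator -/

/-- The character `e^{-2πikx}`. -/
def wave (x k : ℝ) : ℂ := Complex.exp (((-2 * π * k * x : ℝ) : ℂ) * Complex.I)

lemma norm_wave (x k : ℝ) : ‖wave x k‖ = 1 := Complex.norm_exp_ofReal_mul_I _

lemma continuous_wave : Continuous fun p : ℝ × ℝ => wave p.1 p.2 := by
  unfold wave; fun_prop

lemma wave_add (x y k : ℝ) : wave (x + y) k = wave x k * wave y k := by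
  unfold wave; rw [← Complex.exp_add]; congr 1; push_cast; ring

lemma fourier_eq_integral_wave (m : ℝ → ℂ) (x : ℝ) : 𝓕 m x = ∫ k, wave x k * m k := by
  rw [Real.fourier_real_eq_integral_exp_smul]; rfl

lemma integrable_wave_mul {m : ℝ → ℂ} (hm : Integrable m) (x : ℝ) :
    Integrable fun k => wave x k * m k :=
  hm.bdd_mul (c := 1)
    (continuous_wave.comp (Continuous.prodMk_right x)).aestronglyMeasurable
    (Eventually.of_forall fun k => (norm_wave x k).le)

lemma norm_fourier_le (m : ℝ → ℂ) (x : ℝ) : ‖𝓕 m x‖ ≤ ∫ k, ‖m k‖ := by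
  rw [fourier_eq_integral_wave]
  refine (norm_integral_le_integral_norm _).trans (le_of_eq ?_)
  simp [norm_wave]

/-- `m` has finite second moment. -/
def SecondMoment (m : ℝ → ℂ) : Prop :=
  Integrable m ∧ Integrable fun k : ℝ => ((k ^ 2 : ℝ) : ℂ) * m k

lemma SecondMoment.integrable_smul {m : ℝ → ℂ} (hm : SecondMoment m) :
    Integrable fun k : ℝ => k • m k := by
  refine (hm.1.norm.add hm.2.norm).mono'
    (continuous_id.aestronglyMeasurable.smul hm.1.aestronglyMeasurable)
    (Eventually.of_forall fun k => ?_)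
  simp only [norm_smul, norm_mul, Complex.norm_real, Real.norm_eq_abs, abs_pow, Pi.add_apply]
  nlinarith [norm_nonneg (m k), mul_nonneg (sq_nonneg (|k| - 1)) (norm_nonneg (m k)),
    mul_nonneg (sq_nonneg |k|) (norm_nonneg (m k))]

lemma SecondMoment.mul_of_bound {m s : ℝ → ℂ} (hm : SecondMoment m) {C : ℝ}
    (hs : AEStronglyMeasurable s) (hC : ∀ k, ‖s k‖ ≤ C * (1 + k ^ 2)) :
    Integrable fun k => s k * m k := by
  refine ((hm.1.norm.add hm.2.norm).const_mul C).mono' (hs.mul hm.1.aestronglyMeasurable)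
    (Eventually.of_forall fun k => ?_)
  simp only [norm_mul, Complex.norm_real, Real.norm_eq_abs, abs_pow, Pi.add_apply, sq_abs]
  calc ‖s k‖ * ‖m k‖ ≤ (C * (1 + k ^ 2)) * ‖m k‖ := by gcongr; exact hC k
    _ = _ := by ring

lemma SecondMoment.mul_of_bounded {m s : ℝ → ℂ} (hm : SecondMoment m) {C : ℝ}
    (hs : AEStronglyMeasurable s) (hC : ∀ k, ‖s k‖ ≤ C) :
    SecondMoment fun k => s k * m k := by
  refine ⟨hm.1.bdd_mul (c := C) hs (Eventually.of_forall hC), ?_⟩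
  have := hm.2.bdd_mul (c := C) hs (Eventually.of_forall hC)
  refine this.congr (Eventually.of_forall fun k => ?_)
  simp only
  ring

lemma hasDerivAt_re_fourier {m : ℝ → ℂ} (hm : Integrable m)
    (hm' : Integrable fun k : ℝ => k • m k) (x : ℝ) :
    HasDerivAt (fun y => (𝓕 m y).re) (𝓕 (fun k : ℝ => (-2 * π * Complex.I * k) * m k) x).re x := by
  have := Real.hasDerivAt_fourier hm hm' x
  exact (Complex.reCLM.hasFDerivAt.comp_hasDerivAt x this)

lemma SecondMoment.bddC2 {m : ℝ → ℂ} (hm : SecondMoment m) : BddC2 fun x => (𝓕 m x).re := by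
  refine ⟨?_, ∫ k, ‖m k‖, fun x => (Complex.abs_re_le_norm _).trans (norm_fourier_le m x)⟩
  have : ContDiff ℝ ((2 : ℕ∞) : WithTop ℕ∞) (𝓕 m) := by
    refine Real.contDiff_fourier fun n hn => ?_
    have hn' : n ≤ 2 := by exact_mod_cast hn
    interval_cases n
    · simpa using hm.1.norm
    · simpa [norm_smul] using hm.integrable_smul.norm
    · simpa using hm.2.norm
  exact Complex.reCLM.contDiff.comp this

/-- The kernel `e^{-2πit} - 1 + 2πit`. -/
def jumpKernel (t : ℝ) : ℂ := wave 1 t - 1 + ((2 * π * t : ℝ) : ℂ) * Complex.I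

lemma continuous_jumpKernel : Continuous jumpKernel := by
  unfold jumpKernel wave; fun_prop

lemma jumpKernel_zero : jumpKernel 0 = 0 := by simp [jumpKernel, wave]

lemma conj_jumpKernel (t : ℝ) : conj (jumpKernel t) = jumpKernel (-t) := by
  simp [jumpKernel, wave, ← Complex.exp_conj, map_ofNat]

lemma re_jumpKernel (t : ℝ) : (jumpKernel t).re = Real.cos (2 * π * t) - 1 := by
  simp only [jumpKernel, wave, Complex.add_re, Complex.sub_re, Complex.exp_ofReal_mul_I_re,
    Complex.one_re, Complex.re_ofReal_mul, Complex.I_re]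
  rw [← Real.cos_neg]; ring_nf

lemma norm_jumpKernel_le (t : ℝ) :
    ‖jumpKernel t‖ ≤ 2 * |2 * π * t| ∧ ‖jumpKernel t‖ ≤ 3 * |2 * π * t| ^ 2 := by
  set s : ℝ := -2 * π * t with hs
  have e1 : jumpKernel t = Complex.exp (Complex.I * s) - 1 - Complex.I * s := by
    simp only [jumpKernel, wave, hs]; push_cast; ring_nf
  have e2 : |2 * π * t| = |s| := by rw [hs, ← abs_neg]; ring_nf
  have h1 : ‖Complex.exp (Complex.I * s) - 1‖ ≤ |s| := Real.norm_exp_I_mul_ofReal_sub_one_le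
  have h2 : ‖Complex.I * (s : ℂ)‖ = |s| := by simp
  have h3 := norm_sub_le (Complex.exp (Complex.I * s) - 1) (Complex.I * s)
  rw [e1, e2]
  refine ⟨by linarith, ?_⟩
  rcases le_total |s| 1 with h | h
  · have := Complex.norm_exp_sub_one_sub_id_le (x := Complex.I * s) (by rw [h2]; exact h)
    rw [h2] at this
    nlinarith [sq_nonneg |s|]
  · nlinarith

lemma norm_jumpKernel_mul_le (k : ℝ) {s ξ : ℝ} (hs : |s| = 1) (hξ : 0 < ξ) :
    ‖jumpKernel (s * k * ξ)‖ ≤ 12 * π ^ 2 * (1 + k ^ 2) * min (ξ ^ 2) ξ := by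
  have h := norm_jumpKernel_le (s * k * ξ)
  have e : |2 * π * (s * k * ξ)| = 2 * π * (|k| * ξ) := by
    simp only [abs_mul, hs, abs_of_pos hξ, abs_of_pos Real.pi_pos, Nat.abs_ofNat]; ring
  rw [e] at h
  have hp := Real.pi_gt_three
  rw [mul_min_of_nonneg _ _ (by positivity)]
  refine le_min (h.2.trans ?_) (h.1.trans ?_)
  · have : 0 ≤ π ^ 2 * ξ ^ 2 := by positivity
    calc 3 * (2 * π * (|k| * ξ)) ^ 2 = 12 * (π ^ 2 * ξ ^ 2) * k ^ 2 := by rw [← sq_abs k]; ring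
      _ ≤ _ := by nlinarith
  · have h1 : 2 * |k| ≤ 1 + k ^ 2 := by nlinarith [sq_nonneg (|k| - 1), sq_abs k]
    calc 2 * (2 * π * (|k| * ξ)) = 2 * π * ξ * (2 * |k|) := by ring
      _ ≤ 2 * π * ξ * (1 + k ^ 2) := by gcongr
      _ ≤ 12 * π ^ 2 * (1 + k ^ 2) * ξ := by
        have : 0 ≤ π * ξ * (1 + k ^ 2) := by positivity
        nlinarith

/-- The symbol of the one-sided singular integral operator. -/
def jumpSymbol (α k : ℝ) : ℂ := ∫ ξ in Ioi (0 : ℝ), jumpKernel (k * ξ) / ((ξ ^ (1 + α) : ℝ) : ℂ)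

lemma jumpSymbol_neg (α k : ℝ) : jumpSymbol α (-k) = conj (jumpSymbol α k) := by
  unfold jumpSymbol
  rw [← integral_conj]
  congr 1 with ξ
  rw [map_div₀, conj_jumpKernel, Complex.conj_ofReal, neg_mul]

lemma jumpSymbol_zero (α : ℝ) : jumpSymbol α 0 = 0 := by
  simp [jumpSymbol, jumpKernel_zero]

/-- Substitution `ξ ↦ kξ`. By homogeneity the symbol is determined by its value at `1`, of which
only the sign of the real part is ever needed. -/
lemma jumpSymbol_of_pos (α : ℝ) {k : ℝ} (hk : 0 < k) :
    jumpSymbol α k = ((k ^ α : ℝ) : ℂ) * jumpSymbol α 1 := by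
  have h := integral_comp_mul_left_Ioi
    (fun ξ : ℝ => jumpKernel ξ / ((ξ ^ (1 + α) : ℝ) : ℂ)) 0 hk
  have h2 : jumpSymbol α k = ∫ ξ in Ioi (0 : ℝ), ((k ^ (1 + α) : ℝ) : ℂ) *
      (jumpKernel (k * ξ) / (((k * ξ) ^ (1 + α) : ℝ) : ℂ)) := by
    refine setIntegral_congr_fun measurableSet_Ioi fun ξ hξ => ?_
    have hξ' : (0 : ℝ) < ξ := hξ
    have h1 : ((k ^ (1 + α) : ℝ) : ℂ) ≠ 0 := by
      exact_mod_cast (Real.rpow_pos_of_pos hk _).ne'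
    have h3 : ((ξ ^ (1 + α) : ℝ) : ℂ) ≠ 0 := by
      exact_mod_cast (Real.rpow_pos_of_pos hξ' _).ne'
    rw [Real.mul_rpow hk.le hξ'.le]
    push_cast
    field_simp
  rw [h2, integral_const_mul, h, mul_zero, jumpSymbol]
  simp only [one_mul]
  rw [Complex.real_smul, ← mul_assoc, ← Complex.ofReal_mul]
  congr 2
  rw [Real.rpow_add hk, Real.rpow_one]
  field_simp

lemma integrableOn_jumpKernel {α : ℝ} (hα : 1 < α) (hα' : α < 2) :
    IntegrableOn (fun ξ : ℝ => jumpKernel (1 * ξ) / ((ξ ^ (1 + α) : ℝ) : ℂ)) (Ioi 0) := by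
  refine Integrable.mono' ((integrableOn_jumpMajorant hα hα').const_mul (12 * π ^ 2 * (1 + 1 ^ 2)))
    ?_ ?_
  · have := continuous_jumpKernel.measurable
    exact Measurable.aestronglyMeasurable (by fun_prop)
  · filter_upwards [ae_restrict_mem measurableSet_Ioi] with ξ hξ
    have hp : (0 : ℝ) < ξ ^ (1 + α) := Real.rpow_pos_of_pos hξ _
    rw [norm_div, Complex.norm_real, Real.norm_eq_abs, abs_of_pos hp, jumpMajorant, ← mul_div_assoc]
    have := norm_jumpKernel_mul_le 1 (s := 1) (by simp) hξ
    rw [mul_one] at this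
    exact div_le_div_of_nonneg_right this hp.le

/-- The real part is minus the integral of `(1 - cos 2πξ) / ξ^{1+α}`, which is nonnegative and
vanishes at no point of `(0, 1)`. -/
lemma re_jumpSymbol_one_neg {α : ℝ} (hα : 1 < α) (hα' : α < 2) : (jumpSymbol α 1).re < 0 := by
  have hint := integrableOn_jumpKernel hα hα'
  have e : (jumpSymbol α 1).re = -∫ ξ in Ioi (0 : ℝ), (1 - Real.cos (2 * π * ξ)) / ξ ^ (1 + α) := by
    rw [jumpSymbol, ← integral_neg]
    refine (integral_re (𝕜 := ℂ) hint).symm.trans ?_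
    congr 1 with ξ
    change (jumpKernel (1 * ξ) / ((ξ ^ (1 + α) : ℝ) : ℂ)).re = _
    rw [Complex.div_ofReal_re, re_jumpKernel, one_mul]; ring
  rw [e, neg_lt_zero]
  have hint' : IntegrableOn (fun ξ : ℝ => (1 - Real.cos (2 * π * ξ)) / ξ ^ (1 + α)) (Ioi 0) := by
    refine (hint.re.neg).congr (Eventually.of_forall fun ξ => ?_)
    change -(jumpKernel (1 * ξ) / ((ξ ^ (1 + α) : ℝ) : ℂ)).re = _
    rw [Complex.div_ofReal_re, re_jumpKernel, one_mul]; ring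
  rw [setIntegral_pos_iff_support_of_nonneg_ae ?_ hint']
  · have hsub : Ioo (0 : ℝ) 1 ⊆ Function.support
        (fun ξ : ℝ => (1 - Real.cos (2 * π * ξ)) / ξ ^ (1 + α)) ∩ Ioi 0 := by
      intro ξ hξ
      refine ⟨?_, hξ.1⟩
      have hp : (0 : ℝ) < ξ ^ (1 + α) := Real.rpow_pos_of_pos hξ.1 _
      refine div_ne_zero (fun h => ?_) hp.ne'
      have h1 : Real.cos (2 * π * ξ) = 1 := by linarith
      obtain ⟨n, hn⟩ := (Real.cos_eq_one_iff _).1 h1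
      have hn' : (n : ℝ) = ξ := by
        have : 2 * π ≠ 0 := by positivity
        apply mul_right_cancel₀ this; linarith
      have a1 : (0 : ℝ) < n := by rw [hn']; exact hξ.1
      have a2 : (n : ℝ) < 1 := by rw [hn']; exact hξ.2
      have b1 : 0 < n := by exact_mod_cast a1
      have b2 : n < 1 := by exact_mod_cast a2
      omega
    refine lt_of_lt_of_le ?_ (measure_mono hsub)
    simp
  · filter_upwards [ae_restrict_mem measurableSet_Ioi] with ξ hξ
    have hp : (0 : ℝ) < ξ ^ (1 + α) := Real.rpow_pos_of_pos hξ _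
    exact div_nonneg (by linarith [Real.cos_le_one (2 * π * ξ)]) hp.le

/-- Fubini: the increment of each character is that character times `jumpKernel`. The sign `s = ±1`
covers jumps to the right and to the left. -/
lemma integral_incr_re_fourier {α : ℝ} (hα : 1 < α) (hα' : α < 2) {m : ℝ → ℂ}
    (hm : SecondMoment m) {s : ℝ} (hs : |s| = 1) (x : ℝ) :
    Integrable (fun k => jumpSymbol α (s * k) * m k) ∧
    ∫ ξ in Ioi (0 : ℝ), ((𝓕 m (x + s * ξ)).re - (𝓕 m x).re -
      deriv (fun y => (𝓕 m y).re) x * (s * ξ)) / ξ ^ (1 + α) =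
      (𝓕 (fun k => jumpSymbol α (s * k) * m k) x).re := by
  have hmm := hm.integrable_smul
  set H : ℝ → ℝ → ℂ := fun ξ k =>
    (jumpKernel (s * k * ξ) / ((ξ ^ (1 + α) : ℝ) : ℂ)) * (wave x k * m k) with hH
  have hw := integrable_wave_mul hm.1 x
  have hw2 : Integrable fun k : ℝ => k • (wave x k * m k) := by
    refine (integrable_wave_mul hmm x).congr (Eventually.of_forall fun k => ?_)
    simp only [Complex.real_smul]; ring
  have hint : Integrable (Function.uncurry H) ((volume.restrict (Ioi 0)).prod volume) := by
    have hmaj : Integrable (fun p : ℝ × ℝ => (jumpMajorant α p.1) *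
        (12 * π ^ 2 * ‖m p.2‖ + 12 * π ^ 2 * ‖((p.2 ^ 2 : ℝ) : ℂ) * m p.2‖))
        ((volume.restrict (Ioi 0)).prod volume) :=
      (integrableOn_jumpMajorant hα hα').mul_prod
        ((hm.1.norm.const_mul _).add (hm.2.norm.const_mul _))
    refine hmaj.mono' ?_ ?_
    · have h1 : AEStronglyMeasurable (fun p : ℝ × ℝ => wave x p.2 * m p.2)
        ((volume.restrict (Ioi 0)).prod volume) := hw.aestronglyMeasurable.comp_snd
      have h2 : Measurable (fun p : ℝ × ℝ =>
          jumpKernel (s * p.2 * p.1) / ((p.1 ^ (1 + α) : ℝ) : ℂ)) := by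
        have := continuous_jumpKernel.measurable
        fun_prop
      exact h2.aestronglyMeasurable.mul h1
    · have : ∀ᵐ p : ℝ × ℝ ∂((volume.restrict (Ioi 0)).prod volume), p.1 ∈ Ioi (0 : ℝ) :=
        Measure.quasiMeasurePreserving_fst.ae (ae_restrict_mem measurableSet_Ioi)
      filter_upwards [this] with p hp
      have hp' : (0 : ℝ) < p.1 ^ (1 + α) := Real.rpow_pos_of_pos hp _
      have h1 := norm_jumpKernel_mul_le p.2 hs hp
      simp only [Function.uncurry, hH, norm_mul, norm_div, Complex.norm_real, Real.norm_eq_abs,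
        abs_of_pos hp', norm_wave, one_mul, jumpMajorant, abs_pow, sq_abs]
      calc _ ≤ (12 * π ^ 2 * (1 + p.2 ^ 2) * min (p.1 ^ 2) p.1) / p.1 ^ (1 + α) * ‖m p.2‖ := by
            gcongr
        _ = _ := by ring
  have hswap := integral_integral_swap hint
  have hR : ∀ k, ∫ ξ in Ioi (0 : ℝ), H ξ k = wave x k * (jumpSymbol α (s * k) * m k) := fun k => by
    simp only [hH]
    rw [integral_mul_const, jumpSymbol]
    ring
  have hL : ∀ ξ ∈ Ioi (0 : ℝ), (∫ k, H ξ k).re = ((𝓕 m (x + s * ξ)).re - (𝓕 m x).re -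
      deriv (fun y => (𝓕 m y).re) x * (s * ξ)) / ξ ^ (1 + α) := fun ξ hξ => by
    have e : ∀ k, H ξ k = ((((ξ ^ (1 + α))⁻¹ : ℝ)) : ℂ) * ((wave (x + s * ξ) k * m k -
        wave x k * m k) - ((s * ξ : ℝ) : ℂ) *
          (wave x k * ((-2 * π * Complex.I * k) * m k))) := fun k => by
      have : wave 1 (s * k * ξ) = wave (s * ξ) k := by
        unfold wave; congr 3; ring
      simp only [hH, jumpKernel, wave_add, this]
      push_cast
      ring
    have i3 : Integrable fun k : ℝ => (-2 * π * Complex.I * k) * m k := by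
      refine (hmm.const_mul (-2 * π * Complex.I)).congr (Eventually.of_forall fun k => ?_)
      simp only [Complex.real_smul]; ring
    rw [(hasDerivAt_re_fourier hm.1 hmm x).deriv]
    simp only [e]
    rw [integral_const_mul, integral_sub, integral_sub, integral_const_mul,
      ← fourier_eq_integral_wave, ← fourier_eq_integral_wave, ← fourier_eq_integral_wave,
      Complex.re_ofReal_mul, Complex.sub_re, Complex.sub_re, Complex.re_ofReal_mul]
    · ring
    · exact integrable_wave_mul hm.1 _
    · exact integrable_wave_mul hm.1 _
    · exact (integrable_wave_mul hm.1 _).sub (integrable_wave_mul hm.1 _)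
    · exact (integrable_wave_mul i3 x).const_mul _
  have hi1 : Integrable fun k => wave x k * (jumpSymbol α (s * k) * m k) := by
    simpa only [Function.uncurry, hR] using hint.integral_prod_right
  constructor
  · have := hi1.bdd_mul (c := 1) (f := fun k => wave (-x) k)
      (continuous_wave.comp (Continuous.prodMk_right (-x))).aestronglyMeasurable
      (Eventually.of_forall fun k => (norm_wave (-x) k).le)
    refine this.congr (Eventually.of_forall fun k => ?_)
    simp only
    rw [← mul_assoc, ← wave_add]
    simp [wave]
  · rw [← setIntegral_congr_fun measurableSet_Ioi hL, fourier_eq_integral_wave]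
    simp only [hR] at hswap
    rw [← hswap]
    exact (integral_re (𝕜 := ℂ) hint.integral_prod_left)

/-- The homogeneous symbol which equals `a k^α` for `k ≥ 0` and `conj a |k|^α` for `k < 0`. -/
def stableSymbol (α : ℝ) (a : ℂ) (k : ℝ) : ℂ :=
  ((|k| ^ α : ℝ) : ℂ) * if 0 ≤ k then a else conj a

section Symbol

variable {α : ℝ} {a : ℂ}

lemma re_stableSymbol (k : ℝ) : (stableSymbol α a k).re = |k| ^ α * a.re := by
  unfold stableSymbol
  rw [Complex.re_ofReal_mul]
  split_ifs <;> simp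

lemma norm_stableSymbol (k : ℝ) : ‖stableSymbol α a k‖ = |k| ^ α * ‖a‖ := by
  unfold stableSymbol
  rw [norm_mul, Complex.norm_real, Real.norm_of_nonneg (by positivity)]
  split_ifs <;> simp

lemma conj_stableSymbol (hα : 1 < α) (k : ℝ) :
    conj (stableSymbol α a k) = stableSymbol α a (-k) := by
  unfold stableSymbol
  rw [map_mul, Complex.conj_ofReal, abs_neg]
  rcases lt_trichotomy k 0 with h | rfl | h
  · simp [h.not_ge, h.le]
  · simp [Real.zero_rpow (by linarith : α ≠ 0)]
  · simp [h.not_ge, h.le]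

lemma measurable_stableSymbol : Measurable (stableSymbol α a) := by
  unfold stableSymbol
  refine Measurable.mul (by fun_prop) ?_
  exact Measurable.ite measurableSet_Ici measurable_const measurable_const

lemma abs_rpow_le (hα : 1 < α) (hα' : α ≤ 2) (k : ℝ) : |k| ^ α ≤ 1 + k ^ 2 := by
  rcases le_total |k| 1 with h | h
  · have := Real.rpow_le_one (abs_nonneg k) h (by linarith : 0 ≤ α)
    nlinarith [sq_nonneg k]
  · have := Real.rpow_le_rpow_of_exponent_le h hα'
    rw [Real.rpow_two, sq_abs] at this
    linarith

lemma norm_stableSymbol_le (hα : 1 < α) (hα' : α ≤ 2) (k : ℝ) :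
    ‖stableSymbol α a k‖ ≤ ‖a‖ * (1 + k ^ 2) := by
  rw [norm_stableSymbol, mul_comm]
  exact mul_le_mul_of_nonneg_left (abs_rpow_le hα hα' k) (norm_nonneg a)

lemma continuousAt_stableSymbol_one : ContinuousAt (stableSymbol α a) 1 := by
  have h : stableSymbol α a =ᶠ[𝓝 1] fun k => ((|k| ^ α : ℝ) : ℂ) * a := by
    filter_upwards [lt_mem_nhds zero_lt_one] with k hk
    simp [stableSymbol, hk.le]
  refine ContinuousAt.congr ?_ h.symm
  refine ContinuousAt.mul ?_ continuousAt_const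
  exact Complex.continuous_ofReal.continuousAt.comp
    (continuous_abs.continuousAt.rpow_const (by simp))

/-- The multiplier `e^{tψ(k)}`. -/
def stableMultiplier (α : ℝ) (a : ℂ) (t k : ℝ) : ℂ := Complex.exp (t * stableSymbol α a k)

lemma norm_stableMultiplier (t k : ℝ) :
    ‖stableMultiplier α a t k‖ = exp (t * (|k| ^ α * a.re)) := by
  rw [stableMultiplier, Complex.norm_exp, Complex.re_ofReal_mul, re_stableSymbol]

lemma norm_stableMultiplier_le_one (ha : a.re < 0) {t : ℝ} (ht : 0 ≤ t) (k : ℝ) :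
    ‖stableMultiplier α a t k‖ ≤ 1 := by
  rw [norm_stableMultiplier, Real.exp_le_one_iff]
  exact mul_nonpos_of_nonneg_of_nonpos ht
    (mul_nonpos_of_nonneg_of_nonpos (by positivity) ha.le)

lemma stableMultiplier_add (s t k : ℝ) :
    stableMultiplier α a (s + t) k = stableMultiplier α a s k * stableMultiplier α a t k := by
  unfold stableMultiplier
  rw [← Complex.exp_add]; congr 1; push_cast; ring

lemma stableMultiplier_zero (k : ℝ) : stableMultiplier α a 0 k = 1 := by
  simp [stableMultiplier]

lemma conj_stableMultiplier (hα : 1 < α) (t k : ℝ) :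
    conj (stableMultiplier α a t k) = stableMultiplier α a t (-k) := by
  rw [stableMultiplier, ← Complex.exp_conj, map_mul, Complex.conj_ofReal, conj_stableSymbol hα]
  rfl

lemma measurable_stableMultiplier (t : ℝ) : Measurable (stableMultiplier α a t) := by
  have := measurable_stableSymbol (α := α) (a := a)
  unfold stableMultiplier
  fun_prop

lemma continuous_stableMultiplier_time (k : ℝ) : Continuous fun t => stableMultiplier α a t k := by
  unfold stableMultiplier; fun_prop

lemma integrable_exp_neg_abs : Integrable fun k : ℝ => exp (-|k|) := by
  rw [← integrableOn_univ, ← Iic_union_Ioi (a := (0 : ℝ))]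
  refine IntegrableOn.union ?_ ?_
  · refine (integrableOn_exp_Iic 0).congr_fun (fun k hk => ?_) measurableSet_Iic
    rw [abs_of_nonpos hk, neg_neg]
  · refine (integrableOn_exp_neg_Ioi 0).congr_fun (fun k hk => ?_) measurableSet_Ioi
    simp only [abs_of_pos (show (0 : ℝ) < k from hk)]

/-- Because `α > 1`, the decay beats every linear exponential; this is what makes the kernel extend
to an entire function. -/
lemma integrable_exp_abs_sub_rpow (hα : 1 < α) {c : ℝ} (hc : 0 < c) (C : ℝ) :
    Integrable fun k : ℝ => exp (C * |k| - c * |k| ^ α) := by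
  set M := |C| + 1 with hM
  have hM0 : 0 < M := by positivity
  -- Beyond `ρ` one has `c r^α ≥ M r`; the extra `1` in `M` leaves the decay `e^{-r}`.
  set ρ := (M / c) ^ (1 / (α - 1)) with hρ
  have hρ0 : 0 < ρ := by positivity
  have hα0 : 0 < α - 1 := by linarith
  have key : ∀ r : ℝ, 0 ≤ r → C * r - c * r ^ α ≤ M * ρ - r := fun r hr => by
    have hC : C * r ≤ M * r - r := by nlinarith [le_abs_self C]
    have hp : 0 ≤ c * r ^ α := by positivity
    rcases le_total r ρ with h | h
    · nlinarith
    · have hr0 : 0 < r := hρ0.trans_le h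
      have h1 : M / c ≤ r ^ (α - 1) := by
        have := Real.rpow_le_rpow hρ0.le h hα0.le
        rwa [hρ, ← Real.rpow_mul (by positivity), one_div_mul_cancel hα0.ne', Real.rpow_one] at this
      have h2 : r ^ α = r ^ (α - 1) * r := by
        rw [← Real.rpow_add_one hr0.ne']; congr 1; ring
      rw [div_le_iff₀ hc] at h1
      rw [h2]
      nlinarith [mul_pos hM0 hρ0]
  refine (integrable_exp_neg_abs.const_mul (exp (M * ρ))).mono' ?_ ?_
  · exact Measurable.aestronglyMeasurable (by fun_prop)
  · refine Eventually.of_forall fun k => ?_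
    rw [Real.norm_of_nonneg (exp_pos _).le, ← Real.exp_add]
    exact Real.exp_le_exp.2 (by linarith [key |k| (abs_nonneg k)])

lemma secondMoment_stableMultiplier (hα : 1 < α) (ha : a.re < 0) {t : ℝ} (ht : 0 < t) :
    SecondMoment (stableMultiplier α a t) := by
  have hc : 0 < t * -a.re := mul_pos ht (by linarith)
  have hmeas := (measurable_stableMultiplier (α := α) (a := a) t).aestronglyMeasurable
    (μ := volume)
  constructor
  · refine (integrable_exp_abs_sub_rpow hα hc 0).mono' hmeas (Eventually.of_forall fun k => ?_)
    rw [norm_stableMultiplier]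
    exact Real.exp_le_exp.2 (by ring_nf; rfl)
  · refine ((integrable_exp_abs_sub_rpow hα hc 1).const_mul 2).mono' ?_
      (Eventually.of_forall fun k => ?_)
    · exact (Measurable.aestronglyMeasurable (by fun_prop)).mul hmeas
    · rw [norm_mul, norm_stableMultiplier, Complex.norm_real, Real.norm_of_nonneg (sq_nonneg k),
        ← sq_abs]
      have h1 := Real.quadratic_le_exp_of_nonneg (abs_nonneg k)
      have h2 : |k| ^ 2 ≤ 2 * exp |k| := by nlinarith [abs_nonneg k]
      calc |k| ^ 2 * exp (t * (|k| ^ α * a.re)) ≤ 2 * exp |k| * exp (t * (|k| ^ α * a.re)) := by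
            gcongr
        _ = _ := by rw [mul_assoc, ← Real.exp_add]; congr 2; ring

/-- The left-jump symbol is the conjugate of the right-jump one, so the weighted sum is again
homogeneous and conjugate-symmetric. The value of `a` is recorded only for `α = 2`, where positivity
of the kernel is read off a Gaussian. -/
lemma exists_rieszFeller_symbol {θ : ℝ} (hα : 1 < α) (hα' : α ≤ 2)
    (hθ : |θ| ≤ min α (2 - α)) :
    ∃ a : ℂ, a.re < 0 ∧ (α = 2 → a = -4 * (π : ℂ) ^ 2) ∧ ∀ m : ℝ → ℂ, SecondMoment m → ∀ x,
      rieszFeller α θ (fun y => (𝓕 m y).re) x = (𝓕 (fun k => stableSymbol α a k * m k) x).re := by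
  rcases eq_or_lt_of_le hα' with rfl | hlt
  · refine ⟨-4 * (π : ℂ) ^ 2, ?_, fun _ => rfl, fun m hm x => ?_⟩
    · have : ((-4 : ℂ) * π ^ 2) = ((-4 * π ^ 2 : ℝ) : ℂ) := by push_cast; rfl
      rw [this, Complex.ofReal_re]
      nlinarith [Real.pi_pos]
    · have e : ∀ k : ℝ, stableSymbol 2 (-4 * (π : ℂ) ^ 2) k = -4 * (π : ℂ) ^ 2 * ((k ^ 2 : ℝ) : ℂ) :=
          fun k => by
        have hc : conj (-4 * (π : ℂ) ^ 2) = -4 * (π : ℂ) ^ 2 := by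
          rw [map_mul, map_pow, Complex.conj_ofReal]; simp [map_ofNat]
        rw [stableSymbol, hc, ite_self, Real.rpow_two, sq_abs, mul_comm]
      have i3 : Integrable fun k : ℝ => (-2 * π * Complex.I * k) * m k := by
        refine (hm.integrable_smul.const_mul (-2 * π * Complex.I)).congr
          (Eventually.of_forall fun k => ?_)
        simp only [Complex.real_smul]; ring
      have i4 : Integrable fun k : ℝ => k • ((-2 * π * Complex.I * k) * m k) := by
        refine (hm.2.const_mul (-2 * π * Complex.I)).congr
          (Eventually.of_forall fun k => ?_)
        simp only [Complex.real_smul]; push_cast; ring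
      rw [rieszFeller_two, iteratedDeriv_succ, iteratedDeriv_one]
      have hd : deriv (fun y => (𝓕 m y).re) =
          fun y => (𝓕 (fun k : ℝ => (-2 * π * Complex.I * k) * m k) y).re :=
        funext fun y => (hasDerivAt_re_fourier hm.1 hm.integrable_smul y).deriv
      rw [hd, (hasDerivAt_re_fourier i3 i4 x).deriv]
      refine congrArg (fun h : ℝ → ℂ => (𝓕 h x).re) (funext fun k => ?_)
      rw [e]
      push_cast
      linear_combination (4 * (π : ℂ) ^ 2 * k ^ 2 * m k) * Complex.I_sq
  · set c1 := rieszFellerC1 α θ with hc1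
    set c2 := rieszFellerC2 α θ with hc2
    have h1 : 0 ≤ c1 := rieszFellerC1_nonneg hα hθ
    have h2 : 0 ≤ c2 := rieszFellerC2_nonneg hα hθ
    have h12 : 0 < c1 + c2 := by
      rcases rieszFellerC_pos hα hlt hθ with h | h <;> linarith
    have hJ := re_jumpSymbol_one_neg hα hlt
    refine ⟨c1 * jumpSymbol α 1 + c2 * conj (jumpSymbol α 1), ?_, fun h => absurd h hlt.ne,
      fun m hm x => ?_⟩
    · rw [Complex.add_re, Complex.re_ofReal_mul, Complex.re_ofReal_mul, Complex.conj_re]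
      nlinarith
    · have k1 := integral_incr_re_fourier hα hlt hm (s := 1) (by simp) x
      have k2 := integral_incr_re_fourier hα hlt hm (s := -1) (by simp) x
      have hsymb : ∀ k, stableSymbol α (c1 * jumpSymbol α 1 + c2 * conj (jumpSymbol α 1)) k =
          c1 * jumpSymbol α (1 * k) + c2 * jumpSymbol α (-1 * k) := fun k => by
        rw [one_mul, neg_one_mul, jumpSymbol_neg]
        unfold stableSymbol
        rcases lt_trichotomy k 0 with h | rfl | h
        · have hk : jumpSymbol α k = ((|k| ^ α : ℝ) : ℂ) * conj (jumpSymbol α 1) := by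
            rw [← neg_neg k, jumpSymbol_neg, jumpSymbol_of_pos α (neg_pos.2 h), map_mul,
              Complex.conj_ofReal, neg_neg, abs_of_neg h]
          rw [if_neg h.not_ge, hk]
          simp only [map_add, map_mul, Complex.conj_ofReal, Complex.conj_conj]
          ring
        · simp [jumpSymbol_zero, Real.zero_rpow (by linarith : α ≠ 0)]
        · rw [if_pos h.le, jumpSymbol_of_pos α h, abs_of_pos h]
          simp only [map_mul, Complex.conj_ofReal]
          ring
      rw [rieszFeller, if_neg hlt.ne]
      have e1 := k1.2
      have e2 := k2.2
      simp only [one_mul, neg_one_mul, ← sub_eq_add_neg, mul_neg, sub_neg_eq_add] at e1 e2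
      rw [e1, e2, ← hc1, ← hc2, fourier_eq_integral_wave, fourier_eq_integral_wave,
        fourier_eq_integral_wave, ← Complex.re_ofReal_mul, ← Complex.re_ofReal_mul,
        ← Complex.add_re, ← integral_const_mul, ← integral_const_mul, ← integral_add]
      · congr 2 with k
        rw [hsymb, one_mul, neg_one_mul]
        ring
      · simpa only [one_mul] using (integrable_wave_mul k1.1 x).const_mul (c1 : ℂ)
      · simpa only [neg_one_mul] using (integrable_wave_mul k2.1 x).const_mul (c2 : ℂ)

end Symbol

/-! ### The evolution generated by a stable symbol and its kernel -/

/-- The solution of `S_t = D S` with initial value `re (𝓕 m)`. -/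
def stableEvolution (α : ℝ) (a : ℂ) (m : ℝ → ℂ) (x t : ℝ) : ℝ :=
  (𝓕 (fun k => stableMultiplier α a t k * m k) x).re

/-- The kernel of the evolution. -/
def stableKernel (α : ℝ) (a : ℂ) (x t : ℝ) : ℝ := (𝓕 (stableMultiplier α a t) x).re

/-- The operator `D^α_θ` has the symbol `stableSymbol α a`. -/
def HasSymbol (α θ : ℝ) (a : ℂ) : Prop :=
  ∀ m : ℝ → ℂ, SecondMoment m → ∀ x,
    rieszFeller α θ (fun y => (𝓕 m y).re) x = (𝓕 (fun k => stableSymbol α a k * m k) x).re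

section Evolution

variable {α θ : ℝ} {a : ℂ} {m : ℝ → ℂ}

lemma stableEvolution_zero (x : ℝ) : stableEvolution α a m x 0 = (𝓕 m x).re := by
  simp only [stableEvolution, stableMultiplier_zero, one_mul]

lemma norm_stableMultiplier_mul_le (ha : a.re < 0) {t : ℝ} (ht : 0 ≤ t) (k : ℝ) :
    ‖stableMultiplier α a t k * m k‖ ≤ ‖m k‖ := by
  rw [norm_mul]
  exact mul_le_of_le_one_left (norm_nonneg _) (norm_stableMultiplier_le_one ha ht k)

lemma aestronglyMeasurable_multiplier_mul (hm : Integrable m) (t : ℝ) :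
    AEStronglyMeasurable (fun k => stableMultiplier α a t k * m k) :=
  (measurable_stableMultiplier t).aestronglyMeasurable.mul hm.aestronglyMeasurable

lemma aestronglyMeasurable_wave_mul {s : ℝ → ℂ} (hs : AEStronglyMeasurable s) (x : ℝ) :
    AEStronglyMeasurable (fun k => wave x k * s k) :=
  (continuous_wave.comp (Continuous.prodMk_right x)).aestronglyMeasurable.mul hs

lemma abs_stableEvolution_le (ha : a.re < 0) (hm : Integrable m) (x : ℝ) {t : ℝ} (ht : 0 ≤ t) :
    |stableEvolution α a m x t| ≤ ∫ k, ‖m k‖ := by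
  refine (Complex.abs_re_le_norm _).trans ((norm_fourier_le _ x).trans ?_)
  exact integral_mono (hm.mono (aestronglyMeasurable_multiplier_mul hm t)
    (Eventually.of_forall fun k => norm_stableMultiplier_mul_le ha ht k)).norm hm.norm
    fun k => norm_stableMultiplier_mul_le ha ht k

lemma continuousOn_stableEvolution (ha : a.re < 0) (hm : Integrable m) :
    ContinuousOn (Function.uncurry (stableEvolution α a m)) (univ ×ˢ Ici 0) := by
  refine Complex.continuous_re.comp_continuousOn ?_
  simp only [fourier_eq_integral_wave]
  refine continuousOn_of_dominated (bound := fun k => ‖m k‖) (fun p _ => ?_) (fun p hp => ?_)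
    hm.norm (Eventually.of_forall fun k => ?_)
  · exact aestronglyMeasurable_wave_mul (aestronglyMeasurable_multiplier_mul hm _) _
  · refine Eventually.of_forall fun k => ?_
    rw [norm_mul, norm_wave, one_mul]
    exact norm_stableMultiplier_mul_le ha hp.2 k
  · refine Continuous.continuousOn ?_
    have h1 := (continuous_stableMultiplier_time (α := α) (a := a) k).comp
      (continuous_snd (X := ℝ) (Y := ℝ))
    exact (continuous_wave.comp (continuous_fst.prodMk continuous_const)).mul
      (h1.mul continuous_const)

lemma SecondMoment.stableMultiplier_mul (ha : a.re < 0) (hm : SecondMoment m) {t : ℝ}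
    (ht : 0 ≤ t) : SecondMoment fun k => stableMultiplier α a t k * m k :=
  hm.mul_of_bounded (measurable_stableMultiplier t).aestronglyMeasurable
    (norm_stableMultiplier_le_one ha ht)

lemma bddC2_stableEvolution (ha : a.re < 0) (hm : SecondMoment m) {t : ℝ} (ht : 0 ≤ t) :
    BddC2 fun x => stableEvolution α a m x t :=
  (hm.stableMultiplier_mul ha ht).bddC2

lemma hasDerivAt_stableEvolution (hα : 1 < α) (hα' : α ≤ 2) (ha : a.re < 0)
    (hD : HasSymbol α θ a) (hm : SecondMoment m) (x : ℝ) {t : ℝ} (ht : 0 < t) :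
    HasDerivAt (fun s => stableEvolution α a m x s)
      (rieszFeller α θ (fun y => stableEvolution α a m y t) x) t := by
  have hψ := measurable_stableSymbol (α := α) (a := a)
  have hb : Integrable fun k => stableSymbol α a k * m k :=
    hm.mul_of_bound hψ.aestronglyMeasurable (norm_stableSymbol_le hα hα')
  have hbd : ∀ s ∈ Ioi (0 : ℝ), ∀ k, ‖wave x k * (stableSymbol α a k *
      (stableMultiplier α a s k * m k))‖ ≤ ‖stableSymbol α a k * m k‖ := fun s hs k => by
    rw [norm_mul, norm_wave, one_mul, norm_mul, norm_mul (stableSymbol α a k) (m k)]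
    exact mul_le_mul_of_nonneg_left (norm_stableMultiplier_mul_le ha (le_of_lt hs) k)
      (norm_nonneg _)
  have key := (hasDerivAt_integral_of_dominated_loc_of_deriv_le (μ := volume) (𝕜 := ℝ) (E := ℂ)
    (F := fun s k => wave x k * (stableMultiplier α a s k * m k))
    (F' := fun s k => wave x k * (stableSymbol α a k * (stableMultiplier α a s k * m k)))
    (x₀ := t) (bound := fun k => ‖stableSymbol α a k * m k‖) (Ioi_mem_nhds ht)
    (Eventually.of_forall fun s =>
      aestronglyMeasurable_wave_mul (aestronglyMeasurable_multiplier_mul hm.1 s) x)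
    (integrable_wave_mul (hm.stableMultiplier_mul ha ht.le).1 x)
    (aestronglyMeasurable_wave_mul (hψ.aestronglyMeasurable.mul
      (aestronglyMeasurable_multiplier_mul hm.1 t)) x)
    (Eventually.of_forall fun k s hs => hbd s hs k)
    hb.norm
    (Eventually.of_forall fun k s _ => by
      have h1 : HasDerivAt (fun s : ℝ => (s : ℂ) * stableSymbol α a k) (stableSymbol α a k) s := by
        simpa using (Complex.ofRealCLM.hasDerivAt (x := s)).mul_const (stableSymbol α a k)
      have h2 := ((h1.cexp).mul_const (m k)).const_mul (wave x k)
      refine h2.congr_deriv ?_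
      simp only [stableMultiplier]
      ring)).2
  have e := hD _ (hm.stableMultiplier_mul (α := α) ha ht.le) x
  unfold stableEvolution
  rw [e]
  simp only [fourier_eq_integral_wave]
  exact Complex.reCLM.hasFDerivAt.comp_hasDerivAt t key

lemma stableEvolution_nonneg (hα : 1 < α) (hα' : α ≤ 2) (hθ : |θ| ≤ min α (2 - α))
    (ha : a.re < 0) (hD : HasSymbol α θ a) (hm : SecondMoment m) (h0 : ∀ x, 0 ≤ (𝓕 m x).re)
    (x : ℝ) {t : ℝ} (ht : 0 ≤ t) : 0 ≤ stableEvolution α a m x t := by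
  refine nonneg_of_supersolution hα hα' hθ le_rfl (T := t) (w := stableEvolution α a m)
    ((continuousOn_stableEvolution ha hm.1).mono (prod_mono le_rfl Icc_subset_Ici_self))
    ⟨_, fun x s hs => abs_stableEvolution_le ha hm.1 x hs.1⟩
    (fun x => (stableEvolution_zero (α := α) (a := a) x).symm ▸ h0 x)
    (fun s hs => bddC2_stableEvolution ha hm hs.1.le)
    (fun x s hs => ⟨_, (hasDerivAt_stableEvolution hα hα' ha hD hm x hs.1).hasDerivWithinAt,
      by simp⟩) x t ⟨ht, le_rfl⟩

/-- Semigroup property: the kernel restarted at a positive time is an evolution from data with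
finite second moment, so regularity results for evolutions pass to the kernel. -/
lemma stableKernel_add (x s t : ℝ) :
    stableKernel α a x (s + t) = stableEvolution α a (stableMultiplier α a t) x s := by
  exact congrArg (fun h : ℝ → ℂ => (𝓕 h x).re) (funext (stableMultiplier_add s t))

lemma continuousOn_stableKernel (hα : 1 < α) (ha : a.re < 0) :
    ContinuousOn (Function.uncurry (stableKernel α a)) (univ ×ˢ Ioi 0) := by
  rintro ⟨x, t⟩ ⟨-, ht⟩
  have ht' : 0 < t / 2 := half_pos ht
  have h1 := (continuousOn_stableEvolution (α := α) ha
    (secondMoment_stableMultiplier hα ha ht').1)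
  have h2 : ContinuousAt (Function.uncurry (stableEvolution α a (stableMultiplier α a (t / 2))))
      (x, t - t / 2) :=
    h1.continuousAt (prod_mem_nhds univ_mem (Ici_mem_nhds (by linarith)))
  have h3 : ContinuousAt (fun p : ℝ × ℝ => (p.1, p.2 - t / 2)) (x, t) := by fun_prop
  have h4 : Function.uncurry (stableKernel α a) =
      Function.uncurry (stableEvolution α a (stableMultiplier α a (t / 2))) ∘
        (fun p : ℝ × ℝ => (p.1, p.2 - t / 2)) := by
    ext p
    have := stableKernel_add (α := α) (a := a) p.1 (p.2 - t / 2) (t / 2)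
    rw [sub_add_cancel] at this
    exact this
  rw [h4]
  exact (ContinuousAt.comp (f := fun p : ℝ × ℝ => (p.1, p.2 - t / 2)) h2 h3).continuousWithinAt

lemma bddC2_stableKernel (hα : 1 < α) (ha : a.re < 0) {t : ℝ} (ht : 0 < t) :
    BddC2 fun x => stableKernel α a x t :=
  (secondMoment_stableMultiplier hα ha ht).bddC2

lemma hasDerivAt_stableKernel (hα : 1 < α) (hα' : α ≤ 2) (ha : a.re < 0)
    (hD : HasSymbol α θ a) (x : ℝ) {t : ℝ} (ht : 0 < t) :
    HasDerivAt (fun s => stableKernel α a x s)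
      (rieszFeller α θ (fun y => stableKernel α a y t) x) t := by
  have ht' : 0 < t / 2 := half_pos ht
  have h := hasDerivAt_stableEvolution hα hα' ha hD
    (secondMoment_stableMultiplier hα ha ht') x ht'
  simp only [← stableKernel_add, add_halves] at h
  have h2 := HasDerivAt.comp_sub_const (𝕜 := ℝ) t (t / 2)
    (f := fun s => stableKernel α a x (s + t / 2)) (f' := rieszFeller α θ
      (fun y => stableKernel α a y t) x) (by rwa [sub_half])
  simpa using h2

lemma re_fourier_gaussian_pos {b : ℝ} (hb : 0 < b) (x : ℝ) :
    0 < (𝓕 (fun k : ℝ => Complex.exp (-π * b * k ^ 2)) x).re := by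
  have h := congrFun (fourier_gaussian_pi (b := (b : ℂ)) (by simpa using hb)) x
  rw [h]
  have e : (1 / (b : ℂ) ^ (1 / 2 : ℂ) * Complex.exp (-π / b * x ^ 2)) =
      ((1 / b ^ (1 / 2 : ℝ) * Real.exp (-π / b * x ^ 2) : ℝ) : ℂ) := by
    push_cast
    rw [Complex.ofReal_cpow hb.le]
    push_cast
    rfl
  rw [e, Complex.ofReal_re]
  positivity

lemma secondMoment_gaussian {b : ℝ} (hb : 0 < b) :
    SecondMoment fun k : ℝ => Complex.exp (-π * b * k ^ 2) := by
  -- A Gaussian is itself a stable multiplier, of order 2 at time `π * b`.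
  have h := secondMoment_stableMultiplier (α := 2) (a := -1) one_lt_two (by simp)
    (t := π * b) (by positivity)
  convert h using 2 with k
  simp only [stableMultiplier, stableSymbol, map_neg, map_one, ite_self, Real.rpow_two, sq_abs]
  push_cast
  ring_nf

/-- The kernel is the limit of evolutions from narrowing positive Gaussians, whose multipliers tend
to `1`; each evolution is nonnegative by comparison. -/
lemma stableKernel_nonneg (hα : 1 < α) (hα' : α ≤ 2) (hθ : |θ| ≤ min α (2 - α))
    (ha : a.re < 0) (hD : HasSymbol α θ a) (x : ℝ) {t : ℝ} (ht : 0 < t) :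
    0 ≤ stableKernel α a x t := by
  have hpos : ∀ n : ℕ, (0 : ℝ) < 1 / ((n : ℝ) + 1) := fun n => by positivity
  have hlim : Tendsto (fun n : ℕ => stableEvolution α a
      (fun k : ℝ => Complex.exp (-π * ((1 / ((n : ℝ) + 1) : ℝ) : ℂ) * k ^ 2)) x t) atTop
      (𝓝 (stableKernel α a x t)) := by
    unfold stableEvolution stableKernel
    refine (Complex.continuous_re.tendsto _).comp ?_
    simp only [fourier_eq_integral_wave]
    have hi := (secondMoment_stableMultiplier hα ha ht).1
    refine tendsto_integral_of_dominated_convergence (fun k => ‖stableMultiplier α a t k‖)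
      (fun n => ?_) hi.norm (fun n => Eventually.of_forall fun k => ?_)
      (Eventually.of_forall fun k => ?_)
    · exact aestronglyMeasurable_wave_mul
        (aestronglyMeasurable_multiplier_mul (secondMoment_gaussian (hpos n)).1 t) x
    · rw [norm_mul, norm_wave, one_mul, norm_mul]
      refine mul_le_of_le_one_right (norm_nonneg _) ?_
      have e : (-π * ((1 / ((n : ℝ) + 1) : ℝ) : ℂ) * k ^ 2) =
          ((-π * (1 / ((n : ℝ) + 1)) * k ^ 2 : ℝ) : ℂ) := by push_cast; rfl
      rw [e, Complex.norm_exp, Complex.ofReal_re, Real.exp_le_one_iff]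
      have : 0 ≤ π * (1 / ((n : ℝ) + 1)) * k ^ 2 := by positivity
      linarith
    · have h1 : Tendsto (fun n : ℕ => ((1 / ((n : ℝ) + 1) : ℝ) : ℂ)) atTop (𝓝 ((0 : ℝ) : ℂ)) :=
        (Complex.continuous_ofReal.tendsto 0).comp tendsto_one_div_add_atTop_nhds_zero_nat
      have h2 : Continuous fun z : ℂ =>
          wave x k * (stableMultiplier α a t k * Complex.exp (-π * z * k ^ 2)) := by fun_prop
      have h3 := (h2.tendsto _).comp h1
      simpa using! h3
  exact ge_of_tendsto' hlim fun n => stableEvolution_nonneg hα hα' hθ ha hD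
    (secondMoment_gaussian (hpos n)) (fun x => (re_fourier_gaussian_pos (hpos n) x).le) x ht.le

lemma stableEvolution_fourierInv (hα : 1 < α) (ha : a.re < 0) {g : ℝ → ℝ} (hg : Integrable g)
    (x : ℝ) {t : ℝ} (ht : 0 < t) :
    stableEvolution α a (𝓕⁻ fun y => (g y : ℂ)) x t = ∫ y, stableKernel α a (x - y) t * g y := by
  have hi := (secondMoment_stableMultiplier hα ha ht).1
  set H : ℝ → ℝ → ℂ := fun k y => wave (x - y) k * (stableMultiplier α a t k * (g y : ℂ)) with hH
  have hint : Integrable (Function.uncurry H) (volume.prod volume) := by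
    have h1 : Integrable (fun p : ℝ × ℝ => stableMultiplier α a t p.1 * (g p.2 : ℂ))
      (volume.prod volume) := hi.mul_prod hg.ofReal
    have h2 : Continuous fun p : ℝ × ℝ => wave (x - p.2) p.1 :=
      continuous_wave.comp (f := fun p : ℝ × ℝ => (x - p.2, p.1)) (by fun_prop)
    exact h1.bdd_mul (c := 1) h2.aestronglyMeasurable
      (Eventually.of_forall fun p => (norm_wave _ _).le)
  have hL : ∀ k, ∫ y, H k y =
      wave x k * (stableMultiplier α a t k * (𝓕⁻ (fun y => (g y : ℂ)) k)) := fun k => by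
    rw [Real.fourierInv_eq_fourier_neg, fourier_eq_integral_wave, ← integral_const_mul,
      ← integral_const_mul]
    congr 1 with y
    have : wave (-k) y = wave (-y) k := by unfold wave; congr 3; ring
    simp only [hH]
    rw [sub_eq_add_neg, wave_add, this]
    ring
  have hR : ∀ y, ∫ k, H k y = 𝓕 (stableMultiplier α a t) (x - y) * (g y : ℂ) := fun y => by
    rw [fourier_eq_integral_wave, ← integral_mul_const]
    congr 1 with k
    simp only [hH]
    ring
  have hswap := integral_integral_swap hint
  simp only [hL, hR] at hswap
  rw [stableEvolution, fourier_eq_integral_wave, hswap]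
  have hR' : Integrable fun y => 𝓕 (stableMultiplier α a t) (x - y) * (g y : ℂ) := by
    simpa only [Function.uncurry, hR] using hint.integral_prod_right
  refine (integral_re (𝕜 := ℂ) hR').symm.trans ?_
  congr 1 with y
  change (𝓕 (stableMultiplier α a t) (x - y) * (g y : ℂ)).re = _
  rw [Complex.re_mul_ofReal]
  rfl

end Evolution

/-! ### Strict positivity of the kernel -/

section Positivity

variable {α θ : ℝ} {a : ℂ}

/-- Otherwise Fourier inversion at the continuity point `1` would make an exponential vanish. -/
lemma fourier_stableMultiplier_ne_zero (hα : 1 < α) (ha : a.re < 0) {t : ℝ} (ht : 0 < t) :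
    ∃ x, 𝓕 (stableMultiplier α a t) x ≠ 0 := by
  by_contra! h
  have h0 : 𝓕 (stableMultiplier α a t) = 0 := funext h
  have hi := (secondMoment_stableMultiplier hα ha ht).1
  have hc : ContinuousAt (stableMultiplier α a t) 1 :=
    (continuousAt_const.mul continuousAt_stableSymbol_one).cexp
  have h1 := hi.fourierInv_fourier_eq (by rw [h0]; exact integrable_zero _ _ _) hc
  rw [Real.fourierInv_eq_fourier_neg, h0, fourier_eq_integral_wave] at h1
  simp only [Pi.zero_apply, mul_zero, integral_zero] at h1
  exact Complex.exp_ne_zero _ h1.symm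

/-- Conjugate symmetry of the multiplier. It ensures that a zero of `stableKernel`, a real part, is
a zero of the entire extension. -/
lemma im_fourier_stableMultiplier (hα : 1 < α) (t x : ℝ) :
    (𝓕 (stableMultiplier α a t) x).im = 0 := by
  rw [← Complex.conj_eq_iff_im, fourier_eq_integral_wave, ← integral_conj]
  rw [← integral_neg_eq_self (fun k => wave x k * stableMultiplier α a t k)]
  congr 1 with k
  rw [map_mul, conj_stableMultiplier hα]
  congr 1
  simp [wave, ← Complex.exp_conj, map_ofNat]

/-- The entire extension of the kernel. -/
def entireKernel (α : ℝ) (a : ℂ) (t : ℝ) (z : ℂ) : ℂ :=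
  ∫ k : ℝ, Complex.exp (-2 * π * Complex.I * k * z) * stableMultiplier α a t k

lemma entireKernel_ofReal (t x : ℝ) :
    entireKernel α a t x = 𝓕 (stableMultiplier α a t) x := by
  rw [fourier_eq_integral_wave, entireKernel]
  congr 1 with k
  congr 2
  push_cast; ring

lemma norm_exp_wave_le (k : ℝ) (z : ℂ) :
    ‖Complex.exp (-2 * π * Complex.I * k * z)‖ ≤ exp (2 * π * ‖z‖ * |k|) := by
  refine (Complex.norm_exp_le_exp_norm _).trans (Real.exp_le_exp.2 (le_of_eq ?_))
  simp only [norm_mul, norm_neg, Complex.norm_real, Complex.norm_I, Complex.norm_ofNat,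
    Real.norm_eq_abs, abs_of_pos Real.pi_pos]
  ring

lemma differentiable_entireKernel (hα : 1 < α) (ha : a.re < 0) {t : ℝ} (ht : 0 < t) :
    Differentiable ℂ (entireKernel α a t) := by
  intro z
  have hc : 0 < t * -a.re := mul_pos ht (by linarith)
  have hm := (measurable_stableMultiplier (α := α) (a := a) t)
  have hmeas : ∀ y : ℂ, AEStronglyMeasurable
      (fun k : ℝ => Complex.exp (-2 * π * Complex.I * k * y) * stableMultiplier α a t k) :=
    fun y => (Measurable.aestronglyMeasurable (by fun_prop))
  have hnorm : ∀ C k : ℝ, exp (C * |k|) * ‖stableMultiplier α a t k‖ =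
      exp (C * |k| - (t * -a.re) * |k| ^ α) := fun C k => by
    rw [norm_stableMultiplier, ← Real.exp_add]; congr 1; ring
  set C := 2 * π * (‖z‖ + 1) with hC
  have hbd : ∀ k : ℝ, ∀ y ∈ Metric.ball z 1, ‖(-2 * π * Complex.I * k) *
      (Complex.exp (-2 * π * Complex.I * k * y) * stableMultiplier α a t k)‖ ≤
      2 * π * exp ((C + 1) * |k| - (t * -a.re) * |k| ^ α) := fun k y hy => by
    have hy' : ‖y‖ ≤ ‖z‖ + 1 := by
      have := norm_sub_norm_le y z
      rw [mem_ball_iff_norm] at hy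
      linarith
    have h1 : ‖(-2 * π * Complex.I * k : ℂ)‖ ≤ 2 * π * exp |k| := by
      simp only [norm_mul, norm_neg, Complex.norm_real, Complex.norm_I, Complex.norm_ofNat,
        Real.norm_eq_abs, abs_of_pos Real.pi_pos, mul_one]
      have := Real.add_one_le_exp |k|
      exact mul_le_mul_of_nonneg_left (by linarith) (by positivity)
    have h2 : ‖Complex.exp (-2 * π * Complex.I * k * y)‖ ≤ exp (C * |k|) :=
      (norm_exp_wave_le k y).trans (Real.exp_le_exp.2 (by rw [hC]; gcongr))
    rw [← hnorm, norm_mul, add_mul, one_mul, Real.exp_add]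
    calc _ ≤ (2 * π * exp |k|) * (exp (C * |k|) * ‖stableMultiplier α a t k‖) := by
          rw [norm_mul (Complex.exp _)]
          exact mul_le_mul h1 (mul_le_mul_of_nonneg_right h2 (norm_nonneg _)) (by positivity)
            (by positivity)
      _ = _ := by ring
  refine (hasDerivAt_integral_of_dominated_loc_of_deriv_le (μ := volume) (𝕜 := ℂ) (E := ℂ)
    (F := fun y k => Complex.exp (-2 * π * Complex.I * (k : ℝ) * y) * stableMultiplier α a t k)
    (F' := fun y k => (-2 * π * Complex.I * (k : ℝ)) *
      (Complex.exp (-2 * π * Complex.I * k * y) * stableMultiplier α a t k))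
    (bound := fun k => 2 * π * exp ((C + 1) * |k| - (t * -a.re) * |k| ^ α))
    (Metric.ball_mem_nhds z one_pos) (Eventually.of_forall hmeas) ?_ ?_
    (Eventually.of_forall hbd) ((integrable_exp_abs_sub_rpow hα hc _).const_mul _)
    ?_).2.differentiableAt
  · refine (integrable_exp_abs_sub_rpow hα hc (2 * π * ‖z‖)).mono' (hmeas z)
      (Eventually.of_forall fun k => ?_)
    rw [norm_mul, ← hnorm]
    exact mul_le_mul_of_nonneg_right (norm_exp_wave_le k z) (norm_nonneg _)
  · exact Measurable.aestronglyMeasurable (by fun_prop)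
  · refine Eventually.of_forall fun k y _ => ?_
    have h1 : HasDerivAt (fun y : ℂ => -2 * π * Complex.I * (k : ℝ) * y)
        (-2 * π * Complex.I * (k : ℝ)) y := by
      simpa using (hasDerivAt_id y).const_mul (-2 * π * Complex.I * (k : ℂ))
    refine (h1.cexp.mul_const _).congr_deriv ?_
    ring

/-- Identity theorem for the entire extension: zeros filling a real interval accumulate. -/
lemma not_eqOn_zero_stableKernel (hα : 1 < α) (ha : a.re < 0) {t : ℝ} (ht : 0 < t) {b c : ℝ}
    (hbc : b < c) : ∃ x ∈ Ioo b c, stableKernel α a x t ≠ 0 := by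
  by_contra! h
  obtain ⟨x, hx⟩ := fourier_stableMultiplier_ne_zero hα ha ht
  obtain ⟨p, hp⟩ := nonempty_Ioo.2 hbc
  have han : AnalyticOnNhd ℂ (entireKernel α a t) univ :=
    (differentiable_entireKernel hα ha ht).differentiableOn.analyticOnNhd isOpen_univ
  have hzero : ∀ y ∈ Ioo b c, entireKernel α a t (y : ℂ) = 0 := fun y hy => by
    rw [entireKernel_ofReal]
    exact Complex.ext (h y hy) (im_fourier_stableMultiplier hα t y)
  have hfreq : ∃ᶠ z in 𝓝[≠] (p : ℂ), entireKernel α a t z = 0 := by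
    have h1 : Tendsto (fun y : ℝ => (y : ℂ)) (𝓝[≠] p) (𝓝[≠] (p : ℂ)) :=
      tendsto_nhdsWithin_of_tendsto_nhds_of_eventually_within _
        ((Complex.continuous_ofReal.tendsto p).mono_left nhdsWithin_le_nhds)
        (by filter_upwards [self_mem_nhdsWithin] with y hy
            exact fun e => hy (Complex.ofReal_injective e))
    refine h1.frequently (Eventually.frequently ?_)
    filter_upwards [mem_nhdsWithin_of_mem_nhds (Ioo_mem_nhds hp.1 hp.2)] with y hy
    exact hzero y hy
  have hall := han.eqOn_zero_of_preconnected_of_frequently_eq_zero isPreconnected_univ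
    (mem_univ _) hfreq
  apply hx
  rw [← entireKernel_ofReal]
  exact hall (mem_univ _)

lemma eq_zero_of_integral_incr_eq_zero (hα : 1 < α) (hα' : α < 2) {g : ℝ → ℝ} (hg : BddC2 g)
    (h0 : ∀ y, 0 ≤ g y) {x : ℝ} (hx : g x = 0)
    (hI : ∫ ξ in Ioi (0 : ℝ), (g (x + ξ) - g x - deriv g x * ξ) / ξ ^ (1 + α) = 0) :
    ∀ y ∈ Ioi x, g y = 0 := by
  have hd : deriv g x = 0 :=
    IsLocalMin.deriv_eq_zero (Eventually.of_forall fun y => by simpa only [hx] using h0 y)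
  have hint := hg.integrableOn_incr hα hα' x
  rw [setIntegral_eq_zero_iff_of_nonneg_ae ?_ hint] at hI
  · have hz : (fun ξ => g (x + ξ)) =ᵐ[volume.restrict (Ioi 0)] fun _ => 0 := by
      filter_upwards [hI, ae_restrict_mem measurableSet_Ioi] with ξ h hξ
      have hp : (0 : ℝ) < ξ ^ (1 + α) := Real.rpow_pos_of_pos hξ _
      simpa [hx, hd, hp.ne'] using h
    have heq := Measure.eqOn_open_of_ae_eq hz isOpen_Ioi
      (hg.1.continuous.comp (continuous_const.add continuous_id)).continuousOn continuousOn_const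
    intro y hy
    simpa using heq (mem_Ioi.2 (sub_pos.2 (mem_Ioi.1 hy)))
  · filter_upwards [ae_restrict_mem measurableSet_Ioi] with ξ hξ
    have hp : (0 : ℝ) < ξ ^ (1 + α) := Real.rpow_pos_of_pos hξ _
    simpa [hx, hd] using div_nonneg (h0 (x + ξ)) hp.le

/-- At a zero minimum both one-sided integrands are nonnegative. A side with positive weight must
then carry a vanishing integral, so `g` vanishes on that half-line; the left side reduces to the
right by reflection. -/
lemma exists_Ioo_eq_zero_of_rieszFeller_eq_zero (hα : 1 < α) (hα' : α < 2)
    (hθ : |θ| ≤ min α (2 - α)) {g : ℝ → ℝ} (hg : BddC2 g) (h0 : ∀ y, 0 ≤ g y) {x : ℝ}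
    (hx : g x = 0) (hI : rieszFeller α θ g x = 0) : ∃ b c, b < c ∧ ∀ y ∈ Ioo b c, g y = 0 := by
  have hd : deriv g x = 0 :=
    IsLocalMin.deriv_eq_zero (Eventually.of_forall fun y => by simpa only [hx] using h0 y)
  have e1 : 0 ≤ ∫ ξ in Ioi (0 : ℝ), (g (x + ξ) - g x - deriv g x * ξ) / ξ ^ (1 + α) :=
    setIntegral_nonneg measurableSet_Ioi fun ξ hξ => by
      have hp : (0 : ℝ) < ξ ^ (1 + α) := Real.rpow_pos_of_pos hξ _
      simpa [hx, hd] using div_nonneg (h0 (x + ξ)) hp.le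
  have e2 : 0 ≤ ∫ ξ in Ioi (0 : ℝ), (g (x - ξ) - g x + deriv g x * ξ) / ξ ^ (1 + α) :=
    setIntegral_nonneg measurableSet_Ioi fun ξ hξ => by
      have hp : (0 : ℝ) < ξ ^ (1 + α) := Real.rpow_pos_of_pos hξ _
      simpa [hx, hd] using div_nonneg (h0 (x - ξ)) hp.le
  have k1 := rieszFellerC1_nonneg hα hθ
  have k2 := rieszFellerC2_nonneg hα hθ
  rw [rieszFeller, if_neg hα'.ne,
    add_eq_zero_iff_of_nonneg (mul_nonneg k1 e1) (mul_nonneg k2 e2)] at hI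
  rcases rieszFellerC_pos hα hα' hθ with hc | hc
  · have h1 := (mul_eq_zero.1 hI.1).resolve_left hc.ne'
    exact ⟨x, x + 1, by linarith, fun y hy =>
      eq_zero_of_integral_incr_eq_zero hα hα' hg h0 hx h1 y hy.1⟩
  · have h1 := (mul_eq_zero.1 hI.2).resolve_left hc.ne'
    refine ⟨x - 1, x, by linarith, fun y hy => ?_⟩
    have h2 := eq_zero_of_integral_incr_eq_zero hα hα' hg.comp_neg (x := -x) (fun y => h0 (-y))
      (by simpa using hx) (by simpa [deriv_comp_neg_neg, sub_eq_add_neg, add_comm] using h1) (-y)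
      (neg_lt_neg hy.2)
    simpa using h2

lemma stableKernel_pos (hα : 1 < α) (hα' : α ≤ 2) (hθ : |θ| ≤ min α (2 - α))
    (ha : a.re < 0) (ha2 : α = 2 → a = -4 * (π : ℂ) ^ 2) (hD : HasSymbol α θ a) (x : ℝ) {t : ℝ}
    (ht : 0 < t) : 0 < stableKernel α a x t := by
  -- The second derivative is local, so its vanishing at a zero says nothing nearby; `α = 2` needs
  -- the explicit Gaussian.
  rcases eq_or_lt_of_le hα' with rfl | hlt
  · have h := re_fourier_gaussian_pos (b := 4 * π * t) (by positivity) x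
    have e : stableMultiplier 2 a t =
        fun k : ℝ => Complex.exp (-π * ((4 * π * t : ℝ) : ℂ) * k ^ 2) := by
      ext k
      rw [ha2 rfl]
      simp only [stableMultiplier, stableSymbol, map_neg, map_mul, map_pow, map_ofNat,
        Complex.conj_ofReal, ite_self, Real.rpow_two, sq_abs]
      push_cast
      ring_nf
    rwa [stableKernel, e]
  · have hnn := fun y s (hs : 0 < s) => stableKernel_nonneg hα hα' hθ ha hD y hs
    refine lt_of_le_of_ne (hnn x t ht) fun h0 => ?_
    have hder := hasDerivAt_stableKernel hα hα' ha hD x ht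
    -- A zero of a nonnegative kernel is also a minimum in time, so the evolution equation gives a
    -- vanishing `rieszFeller`.
    have hmin : IsLocalMin (fun s => stableKernel α a x s) t := by
      filter_upwards [lt_mem_nhds ht] with s hs
      rw [← h0]
      exact hnn x s hs
    obtain ⟨b, c, hbc, hz⟩ := exists_Ioo_eq_zero_of_rieszFeller_eq_zero hα hlt hθ
      (bddC2_stableKernel hα ha ht) (fun y => hnn y t ht) h0.symm (hmin.hasDerivAt_eq_zero hder)
    obtain ⟨y, hy, hne⟩ := not_eqOn_zero_stableKernel hα ha ht hbc
    exact hne (hz y hy)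

end Positivity

/-! ### Lower bounds by the kernel -/

section LowerBound

variable {α θ : ℝ} {a : ℂ}

lemma secondMoment_fourierInv {g : ℝ → ℝ} (hg : ContDiff ℝ ((⊤ : ℕ∞) : WithTop ℕ∞) g)
    (hs : HasCompactSupport g) :
    SecondMoment (𝓕⁻ fun y => (g y : ℂ)) ∧ ∀ x, (𝓕 (𝓕⁻ fun y => (g y : ℂ)) x).re = g x := by
  have hg' : ContDiff ℝ ((⊤ : ℕ∞) : WithTop ℕ∞) fun y => (g y : ℂ) :=
    Complex.ofRealCLM.contDiff.comp hg
  have hs' : HasCompactSupport fun y => (g y : ℂ) := hs.comp_left Complex.ofReal_zero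
  set φ : SchwartzMap ℝ ℂ := hs'.toSchwartzMap hg' with hφ
  have e : (φ : ℝ → ℂ) = fun y => (g y : ℂ) := rfl
  have e2 : ((𝓕⁻ φ : SchwartzMap ℝ ℂ) : ℝ → ℂ) = 𝓕⁻ fun y => (g y : ℂ) := by
    rw [SchwartzMap.fourierInv_coe, e]
  have h2 := (𝓕⁻ φ : SchwartzMap ℝ ℂ).integrable_pow_mul volume 2
  have hi := (𝓕⁻ φ : SchwartzMap ℝ ℂ).integrable (μ := volume)
  refine ⟨⟨e2 ▸ hi, ?_⟩, fun x => ?_⟩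
  · rw [← e2]
    refine h2.mono' ?_ (Eventually.of_forall fun k => ?_)
    · exact (Measurable.aestronglyMeasurable (by fun_prop)).mul hi.aestronglyMeasurable
    · simp
  · have h3 : 𝓕 (𝓕⁻ φ) = φ := FourierTransform.fourier_fourierInv_eq φ
    have h4 : ((𝓕 (𝓕⁻ φ) : SchwartzMap ℝ ℂ) : ℝ → ℂ) = 𝓕 (𝓕⁻ fun y => (g y : ℂ)) := by
      rw [SchwartzMap.fourier_coe, e2]
    rw [← h4, h3, e, Complex.ofReal_re]

/-- Nonnegative functions `w` on `ℝ × [0, T]` with `w_t ≥ D w - K w`. -/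
structure IsNonnegSupersolution (α θ K T : ℝ) (w : ℝ → ℝ → ℝ) : Prop where
  continuousOn : ContinuousOn (Function.uncurry w) (univ ×ˢ Icc 0 T)
  bounded : ∃ B : ℝ, ∀ x, ∀ t ∈ Icc 0 T, |w x t| ≤ B
  nonneg : ∀ x, ∀ t ∈ Icc 0 T, 0 ≤ w x t
  bddC2 : ∀ t ∈ Ioc 0 T, BddC2 fun x => w x t
  deriv_ge : ∀ x, ∀ t ∈ Ioc 0 T, ∃ w', HasDerivWithinAt (fun s => w x s) w' (Ioc 0 T) t ∧
    rieszFeller α θ (fun y => w y t) x - K * w x t ≤ w'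

/-- The damped evolution `e^{-Kt} S` solves `z_t = D z - K z` exactly, so its difference from `w`
falls under the comparison principle. Smoothness and compact support of `g` provide the finite
second moment of its inverse transform. -/
lemma IsNonnegSupersolution.ge_of_le (hα : 1 < α) (hα' : α ≤ 2) (hθ : |θ| ≤ min α (2 - α))
    (ha : a.re < 0) (hD : HasSymbol α θ a) {K T : ℝ} (hK : 0 ≤ K) {w : ℝ → ℝ → ℝ}
    (hw : IsNonnegSupersolution α θ K T w) {g : ℝ → ℝ}
    (hg : ContDiff ℝ ((⊤ : ℕ∞) : WithTop ℕ∞) g) (hs : HasCompactSupport g)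
    (hgw : ∀ x, g x ≤ w x 0) (x : ℝ) {t : ℝ} (ht : t ∈ Ioc 0 T) :
    exp (-K * t) * ∫ y, stableKernel α a (x - y) t * g y ≤ w x t := by
  obtain ⟨hm, hinv⟩ := secondMoment_fourierInv hg hs
  rw [← stableEvolution_fourierInv hα ha (hg.continuous.integrable_of_hasCompactSupport hs) x ht.1]
  set m := 𝓕⁻ fun y => (g y : ℂ) with hm_def
  set S := stableEvolution α a m with hS
  obtain ⟨B, hB⟩ := hw.bounded
  have hE : ∀ s : ℝ, 0 ≤ s → exp (-K * s) ≤ 1 := fun s hs =>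
    Real.exp_le_one_iff.2 (by nlinarith)
  have hSC2 : ∀ s ∈ Ioc 0 T, BddC2 fun y => S y s := fun s hs =>
    bddC2_stableEvolution ha hm hs.1.le
  have key := nonneg_of_supersolution hα hα' hθ hK (T := T)
    (w := fun x s => w x s - exp (-K * s) * S x s) ?_ ?_ ?_ ?_ ?_ x t ⟨ht.1.le, ht.2⟩
  · linarith
  · have h1 : Continuous fun p : ℝ × ℝ => exp (-K * p.2) := by fun_prop
    exact hw.continuousOn.sub (h1.continuousOn.mul ((continuousOn_stableEvolution ha hm.1).mono
      (prod_mono le_rfl Icc_subset_Ici_self)))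
  · refine ⟨B + ∫ k, ‖m k‖, fun y s hs => (abs_sub _ _).trans (add_le_add (hB y s hs) ?_)⟩
    rw [abs_mul, abs_of_pos (exp_pos _)]
    exact (mul_le_of_le_one_left (abs_nonneg _) (hE s hs.1)).trans
      (abs_stableEvolution_le ha hm.1 y hs.1)
  · intro y
    have : S y 0 = g y := by rw [hS, stableEvolution_zero, hinv]
    simp only [this, mul_zero, exp_zero, one_mul]
    linarith [hgw y]
  · exact fun s hs => (hw.bddC2 s hs).sub ((hSC2 s hs).const_mul _)
  · intro y s hs
    obtain ⟨w', hw', hle⟩ := hw.deriv_ge y s hs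
    have h1 : HasDerivAt (fun s : ℝ => exp (-K * s)) (exp (-K * s) * (-K)) s := by
      simpa using ((hasDerivAt_id s).const_mul (-K)).exp
    have h2 := h1.mul (hasDerivAt_stableEvolution hα hα' ha hD hm y hs.1)
    refine ⟨_, hw'.sub h2.hasDerivWithinAt, ?_⟩
    rw [rieszFeller_sub hα hα' (hw.bddC2 s hs) ((hSC2 s hs).const_mul _),
      rieszFeller_const_mul (hSC2 s hs)]
    have h3 := mul_le_mul_of_nonneg_left (le_abs_self (w y s - exp (-K * s) * S y s)) hK
    rw [hS] at h3 ⊢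
    linarith

lemma continuous_kernel_slice (hα : 1 < α) (ha : a.re < 0) (x : ℝ) {t : ℝ} (ht : 0 < t) :
    Continuous fun y => stableKernel α a (x - y) t :=
  (bddC2_stableKernel hα ha ht).1.continuous.comp (continuous_const.sub continuous_id)

lemma IsNonnegSupersolution.continuous_initial {K T : ℝ} (hT : 0 ≤ T) {w : ℝ → ℝ → ℝ}
    (hw : IsNonnegSupersolution α θ K T w) : Continuous fun y => w y 0 :=
  hw.continuousOn.comp_continuous (f := fun y : ℝ => (y, (0 : ℝ))) (by fun_prop)
    fun y => ⟨mem_univ _, le_rfl, hT⟩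

theorem IsNonnegSupersolution.kernel_integral_le (hα : 1 < α) (hα' : α ≤ 2)
    (hθ : |θ| ≤ min α (2 - α)) (ha : a.re < 0) (hD : HasSymbol α θ a) {K T : ℝ} (hK : 0 ≤ K)
    {w : ℝ → ℝ → ℝ} (hw : IsNonnegSupersolution α θ K T w) (c x : ℝ) {t : ℝ} (ht : t ∈ Ioc 0 T) :
    exp (-K * t) * ∫ y in c..(c + 1), stableKernel α a (x - y) t * w y 0 ≤ w x t := by
  have hT : 0 ≤ T := ht.1.le.trans ht.2
  have hw0 := hw.continuous_initial hT
  have hw0n : ∀ y, 0 ≤ w y 0 := fun y => hw.nonneg y 0 ⟨le_rfl, hT⟩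
  have hG := continuous_kernel_slice hα ha x ht.1
  have hGn : ∀ y, 0 ≤ stableKernel α a (x - y) t := fun y =>
    stableKernel_nonneg hα hα' hθ ha hD _ ht.1
  -- The radii are generous: `χ` is `1` on `[c, c+1]` and `0` off `[c-2, c+3]`.
  let χ : ContDiffBump (c + 1 / 2 : ℝ) := ⟨1, 2, one_pos, one_lt_two⟩
  have hχ1 : ∀ y ∈ Icc c (c + 1), χ y = 1 := fun y hy => χ.one_of_mem_closedBall (by
    rw [Metric.mem_closedBall, Real.dist_eq, abs_le]
    change -1 ≤ _ ∧ _ ≤ (1 : ℝ)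
    constructor <;> linarith [hy.1, hy.2])
  have hχ0 : ∀ y, y ∉ Icc (c - 2) (c + 3) → χ y = 0 := fun y hy => χ.zero_of_le_dist (by
    by_contra! h
    rw [Real.dist_eq, abs_lt] at h
    change -2 < _ ∧ _ < (2 : ℝ) at h
    exact hy ⟨by linarith [h.1], by linarith [h.2]⟩)
  have hχn : ∀ y, 0 ≤ χ y := fun y => χ.nonneg
  have hχs : HasCompactSupport (χ : ℝ → ℝ) := χ.hasCompactSupport
  have hχc : Continuous (χ : ℝ → ℝ) := χ.continuous
  have hint : ∀ h : ℝ → ℝ, Continuous h →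
      Integrable fun y => stableKernel α a (x - y) t * (h y * χ y) := fun h hh =>
    (hG.mul (hh.mul hχc)).integrable_of_hasCompactSupport (hχs.mul_left.mul_left)
  have hE := exp_pos (-K * t)
  set J := ∫ y, stableKernel α a (x - y) t * (1 * χ y) with hJ
  have main : ∀ ε : ℝ, 0 < ε →
      exp (-K * t) * ((∫ y, stableKernel α a (x - y) t * (w y 0 * χ y)) - 3 * ε * J) ≤ w x t := by
    intro ε hε
    -- The initial value is merely continuous. Approximating it after lowering by `2ε` gives `w - 3ε
    -- ≤ p ≤ w - ε`, so `p * χ` is smooth and stays below it.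
    obtain ⟨p, hp⟩ := exists_polynomial_near_of_continuousOn (c - 2) (c + 3)
      (fun y => w y 0 - 2 * ε) (hw0.sub continuous_const).continuousOn ε hε
    have hpc : ContDiff ℝ ((⊤ : ℕ∞) : WithTop ℕ∞) fun y => p.eval y := by
      simpa using p.contDiff_aeval (R := ℝ) (𝕜 := ℝ) ((⊤ : ℕ∞) : WithTop ℕ∞)
    have hle := hw.ge_of_le hα hα' hθ ha hD hK (g := fun y => p.eval y * χ y)
      (hpc.mul χ.contDiff) hχs.mul_left (fun y => by
        by_cases hy : y ∈ Icc (c - 2) (c + 3)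
        · have h1 := (abs_lt.1 (hp y hy)).2
          calc p.eval y * χ y ≤ w y 0 * χ y :=
                mul_le_mul_of_nonneg_right (by linarith) (hχn y)
            _ ≤ w y 0 := mul_le_of_le_one_right (hw0n y) χ.le_one
        · rw [hχ0 y hy, mul_zero]; exact hw0n y) x ht
    refine le_trans (mul_le_mul_of_nonneg_left ?_ hE.le) hle
    rw [hJ, ← integral_const_mul, ← integral_sub (hint _ hw0)
      ((hint _ continuous_const).const_mul _)]
    refine integral_mono ((hint _ hw0).sub ((hint _ continuous_const).const_mul _))
      (hint _ p.continuous) fun y => ?_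
    by_cases hy : y ∈ Icc (c - 2) (c + 3)
    · have h1 := (abs_lt.1 (hp y hy)).1
      have h2 : w y 0 - 3 * ε ≤ p.eval y := by linarith
      have h3 := mul_le_mul_of_nonneg_left h2 (mul_nonneg (hGn y) (hχn y))
      simp only
      linarith
    · simp [hχ0 y hy]
  have hlim : exp (-K * t) * (∫ y, stableKernel α a (x - y) t * (w y 0 * χ y)) ≤ w x t := by
    have hc : Continuous fun ε : ℝ =>
        exp (-K * t) * ((∫ y, stableKernel α a (x - y) t * (w y 0 * χ y)) - 3 * ε * J) := by
      fun_prop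
    have h1 := (hc.tendsto 0).mono_left (nhdsWithin_le_nhds (s := Ioi 0))
    have h2 := le_of_tendsto h1 (by filter_upwards [self_mem_nhdsWithin] with ε hε using main ε hε)
    simpa using h2
  refine le_trans (mul_le_mul_of_nonneg_left ?_ hE.le) hlim
  rw [intervalIntegral.integral_of_le (by linarith)]
  calc ∫ y in Ioc c (c + 1), stableKernel α a (x - y) t * w y 0
      = ∫ y in Ioc c (c + 1), stableKernel α a (x - y) t * (w y 0 * χ y) :=
        setIntegral_congr_fun measurableSet_Ioc fun y hy => by
          simp only [hχ1 y ⟨hy.1.le, hy.2⟩, mul_one]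
    _ ≤ _ := setIntegral_le_integral (hint _ hw0) (Eventually.of_forall fun y =>
        mul_nonneg (hGn y) (mul_nonneg (hw0n y) (hχn y)))

/-- The minimum of the kernel over the interval `[-m-1, m+1]`. -/
def kernelMin (α : ℝ) (a : ℂ) (m t : ℝ) : ℝ :=
  sInf ((fun z => stableKernel α a (z * (m + 1)) t) '' Icc (-1) 1)

/-- Rescaling to `z ∈ [-1, 1]` makes the compact set independent of `m`, so the infimum depends
continuously on the parameters. -/
lemma continuousOn_kernelMin (hα : 1 < α) (ha : a.re < 0) :
    ContinuousOn (Function.uncurry (kernelMin α a)) (Ici 0 ×ˢ Ioi 0) := by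
  rw [continuousOn_iff_continuous_domRestrict]
  refine IsCompact.continuous_sInf (f := fun (p : (Ici (0 : ℝ) ×ˢ Ioi (0 : ℝ) : Set (ℝ × ℝ)))
    (z : ℝ) => stableKernel α a (z * (p.1.1 + 1)) p.1.2) (K := Icc (-1) 1) isCompact_Icc ?_
  exact (continuousOn_stableKernel hα ha).comp_continuous
    (f := fun q : (Ici (0 : ℝ) ×ˢ Ioi (0 : ℝ) : Set (ℝ × ℝ)) × ℝ =>
      (q.2 * (q.1.1.1 + 1), q.1.1.2)) (by fun_prop) fun q => ⟨mem_univ _, q.1.2.2⟩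

lemma isLeast_kernelMin (hα : 1 < α) (ha : a.re < 0) (m : ℝ) {t : ℝ} (ht : 0 < t) :
    IsLeast ((fun z => stableKernel α a (z * (m + 1)) t) '' Icc (-1) 1) (kernelMin α a m t) := by
  have hc : Continuous fun z => stableKernel α a (z * (m + 1)) t :=
    (bddC2_stableKernel hα ha ht).1.continuous.comp (by fun_prop)
  exact (isCompact_Icc.image hc).isLeast_sInf ((nonempty_Icc.2 (by norm_num)).image _)

lemma kernelMin_pos (hα : 1 < α) (hα' : α ≤ 2) (hθ : |θ| ≤ min α (2 - α))
    (ha : a.re < 0) (ha2 : α = 2 → a = -4 * (π : ℂ) ^ 2) (hD : HasSymbol α θ a) (m : ℝ) {t : ℝ}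
    (ht : 0 < t) : 0 < kernelMin α a m t := by
  obtain ⟨z, -, hz⟩ := (isLeast_kernelMin hα ha m ht).1
  rw [← hz]
  exact stableKernel_pos hα hα' hθ ha ha2 hD _ ht

lemma kernelMin_le (hα : 1 < α) (ha : a.re < 0) {m z t : ℝ} (hz : |z| ≤ m + 1) (hm : 0 ≤ m)
    (ht : 0 < t) : kernelMin α a m t ≤ stableKernel α a z t := by
  refine (isLeast_kernelMin hα ha m ht).2 ⟨z / (m + 1), ?_, ?_⟩
  · rw [mem_Icc, ← abs_le, abs_div, abs_of_pos (by linarith : 0 < m + 1)]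
    exact (div_le_one (by linarith)).2 hz
  · simp only
    rw [div_mul_cancel₀ _ (by linarith)]

end LowerBound

/-! ### Sub- and supersolution pairs -/

section Pairs

variable {α θ T R : ℝ} {f : ℝ → ℝ} {u v : ℝ → ℝ → ℝ}

lemma exists_lipschitz_const (hf : ContDiff ℝ 1 f) (R : ℝ) :
    ∃ K : ℝ, 0 ≤ K ∧ ∀ r s, |r| ≤ R → |s| ≤ R → |f r - f s| ≤ K * |r - s| := by
  obtain ⟨K, hK⟩ := isCompact_Icc.exists_bound_of_continuousOn (s := Icc (-R) R)
    (hf.continuous_deriv_one).continuousOn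
  refine ⟨max K 0, le_max_right _ _, fun r s hr hs => ?_⟩
  exact Convex.norm_image_sub_le_of_norm_deriv_le (𝕜 := ℝ) (s := Icc (-R) R)
    (fun z _ => hf.differentiable_one z)
    (fun z hz => (hK z hz).trans (le_max_left _ _)) (convex_Icc _ _) (abs_le.1 hs) (abs_le.1 hr)

lemma IsAdmissible.bddC2 (hu : IsAdmissible T u) {t : ℝ} (ht : t ∈ Ioc 0 T) :
    BddC2 fun x => u x t := by
  obtain ⟨B, hB⟩ := hu.1.2
  refine ⟨?_, B, fun x => hB (x, t) ⟨mem_univ _, ht.1.le, ht.2⟩⟩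
  -- Any `t₀` in `(0, t)` would do; `t / 2` also stays below `T` when `t = T`.
  have h := (hu.2 (t / 2) ⟨half_pos ht.1, by linarith [ht.1, ht.2]⟩).1
  rw [← contDiffOn_univ]
  exact h.comp (g := Function.uncurry u) (f := fun x : ℝ => (x, t)) (by fun_prop)
    fun x _ => ⟨mem_univ _, half_lt_self ht.1, ht.2⟩

lemma IsAdmissible.hasDerivWithinAt (hu : IsAdmissible T u) (x : ℝ) {t : ℝ} (ht : t ∈ Ioc 0 T) :
    HasDerivWithinAt (fun s => u x s) (derivWithin (fun s => u x s) (Ioc 0 T) t) (Ioc 0 T) t := by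
  have h := (hu.2 (t / 2) ⟨half_pos ht.1, by linarith [ht.1, ht.2]⟩).1
  have h1 : ContDiffOn ℝ 2 (fun s => u x s) (Ioc (t / 2) T) :=
    h.comp (g := Function.uncurry u) (f := fun s : ℝ => (x, s)) (by fun_prop)
      fun s hs => ⟨mem_univ _, hs⟩
  have h2 := h1.differentiableOn (by norm_num) t ⟨half_lt_self ht.1, ht.2⟩
  refine (h2.mono_of_mem_nhdsWithin ?_).hasDerivWithinAt
  filter_upwards [self_mem_nhdsWithin, mem_nhdsWithin_of_mem_nhds
    (lt_mem_nhds (half_lt_self ht.1))] with s hs hs' using ⟨hs', hs.2⟩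

lemma pair_deriv_ge (hα : 1 < α) (hα' : α ≤ 2) (hu : IsAdmissible T u) (hv : IsAdmissible T v)
    (hsub : IsSubsolution α θ f T u) (hsup : IsSupersolution α θ f T v) {K : ℝ}
    (hK : ∀ r s, |r| ≤ R → |s| ≤ R → |f r - f s| ≤ K * |r - s|)
    (hR : ∀ x, ∀ t ∈ Icc 0 T, |u x t| ≤ R ∧ |v x t| ≤ R) (x : ℝ) {t : ℝ} (ht : t ∈ Ioc 0 T) :
    ∃ w', HasDerivWithinAt (fun s => v x s - u x s) w' (Ioc 0 T) t ∧
      rieszFeller α θ (fun y => v y t - u y t) x - K * |v x t - u x t| ≤ w' := by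
  refine ⟨_, (hv.hasDerivWithinAt x ht).sub (hu.hasDerivWithinAt x ht), ?_⟩
  rw [rieszFeller_sub hα hα' (hv.bddC2 ht) (hu.bddC2 ht)]
  have hb := hR x t ⟨ht.1.le, ht.2⟩
  have h1 := neg_le_of_abs_le (hK _ _ hb.2 hb.1)
  linarith [hsub x t ht, hsup x t ht]

lemma pair_bounded (hR : ∀ x, ∀ t ∈ Icc 0 T, |u x t| ≤ R ∧ |v x t| ≤ R) :
    ∃ B : ℝ, ∀ x, ∀ t ∈ Icc 0 T, |v x t - u x t| ≤ B :=
  ⟨R + R, fun x t ht => (abs_sub _ _).trans (add_le_add (hR x t ht).2 (hR x t ht).1)⟩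

lemma pair_sub_nonneg (hα : 1 < α) (hα' : α ≤ 2) (hθ : |θ| ≤ min α (2 - α))
    (hu : IsAdmissible T u) (hv : IsAdmissible T v)
    (hsub : IsSubsolution α θ f T u) (hsup : IsSupersolution α θ f T v) {K : ℝ} (hK0 : 0 ≤ K)
    (hK : ∀ r s, |r| ≤ R → |s| ≤ R → |f r - f s| ≤ K * |r - s|)
    (hR : ∀ x, ∀ t ∈ Icc 0 T, |u x t| ≤ R ∧ |v x t| ≤ R) (h0 : ∀ x, u x 0 ≤ v x 0) :
    ∀ x, ∀ t ∈ Icc 0 T, 0 ≤ v x t - u x t :=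
  nonneg_of_supersolution hα hα' hθ hK0 (w := fun x t => v x t - u x t)
    (hv.1.1.sub hu.1.1) (pair_bounded hR) (fun x => sub_nonneg.2 (h0 x))
    (fun _ ht => (hv.bddC2 ht).sub (hu.bddC2 ht))
    fun x _ ht => pair_deriv_ge hα hα' hu hv hsub hsup hK hR x ht

lemma pair_isNonnegSupersolution (hα : 1 < α) (hα' : α ≤ 2) (hθ : |θ| ≤ min α (2 - α))
    (hu : IsAdmissible T u) (hv : IsAdmissible T v)
    (hsub : IsSubsolution α θ f T u) (hsup : IsSupersolution α θ f T v) {K : ℝ} (hK0 : 0 ≤ K)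
    (hK : ∀ r s, |r| ≤ R → |s| ≤ R → |f r - f s| ≤ K * |r - s|)
    (hR : ∀ x, ∀ t ∈ Icc 0 T, |u x t| ≤ R ∧ |v x t| ≤ R) (h0 : ∀ x, u x 0 ≤ v x 0) :
    IsNonnegSupersolution α θ K T fun x t => v x t - u x t where
  continuousOn := hv.1.1.sub hu.1.1
  bounded := pair_bounded hR
  nonneg := pair_sub_nonneg hα hα' hθ hu hv hsub hsup hK0 hK hR h0
  bddC2 _ ht := (hv.bddC2 ht).sub (hu.bddC2 ht)
  deriv_ge x t ht := by
    have h := pair_deriv_ge hα hα' hu hv hsub hsup hK hR x ht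
    rwa [abs_of_nonneg (pair_sub_nonneg hα hα' hθ hu hv hsub hsup hK0 hK hR h0 x t
      ⟨ht.1.le, ht.2⟩)] at h

lemma IsAdmissible.exists_common_bound (hu : IsAdmissible T u) (hv : IsAdmissible T v) :
    ∃ R : ℝ, ∀ x, ∀ t ∈ Icc 0 T, |u x t| ≤ R ∧ |v x t| ≤ R := by
  obtain ⟨B, hB⟩ := hu.1.2
  obtain ⟨C, hC⟩ := hv.1.2
  exact ⟨max B C, fun x t ht => ⟨(hB (x, t) ⟨mem_univ _, ht⟩).trans (le_max_left _ _),
    (hC (x, t) ⟨mem_univ _, ht⟩).trans (le_max_right _ _)⟩⟩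

end Pairs

end

theorem mainTheorem6 (α θ : ℝ) (hα : 1 < α) (hα' : α ≤ 2) (hθ : |θ| ≤ min α (2 - α))
    (f : ℝ → ℝ) (hf : ContDiff ℝ 1 f) :
    (∀ (T : ℝ) (u v : ℝ → ℝ → ℝ), 0 < T → IsAdmissible T u → IsAdmissible T v →
      IsSubsolution α θ f T u → IsSupersolution α θ f T v →
        ((∀ x, u x 0 ≤ v x 0) → ∀ x, ∀ t ∈ Set.Ioc 0 T, u x t ≤ v x t) ∧
        ((∀ x, u x 0 ≤ v x 0) → (∃ x, u x 0 ≠ v x 0) →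
          ∀ x, ∀ t ∈ Set.Ioc 0 T, u x t < v x t)) ∧
    (∀ R : ℝ, ∃ η : ℝ → ℝ → ℝ,
      ContinuousOn (Function.uncurry η) (Set.Ici 0 ×ˢ Set.Ioi 0) ∧
      (∀ m t : ℝ, 0 ≤ m → 0 < t → 0 < η m t) ∧
      ∀ (T : ℝ) (u v : ℝ → ℝ → ℝ), 0 < T → IsAdmissible T u → IsAdmissible T v →
        IsSubsolution α θ f T u → IsSupersolution α θ f T v →
        (∀ x, ∀ t ∈ Set.Icc 0 T, |u x t| ≤ R ∧ |v x t| ≤ R) →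
        (∀ x, u x 0 ≤ v x 0) →
          ∀ x, ∀ t ∈ Set.Ioo 0 T,
            η |x| t * (∫ y in (0 : ℝ)..1, (v y 0 - u y 0)) ≤ v x t - u x t) := by
  obtain ⟨a, ha, ha2, hD⟩ := exists_rieszFeller_symbol hα hα' hθ
  refine ⟨fun T u v hT hu hv hsub hsup => ?_, fun R => ?_⟩
  · obtain ⟨R, hR⟩ := hu.exists_common_bound hv
    obtain ⟨K, hK0, hK⟩ := exists_lipschitz_const hf R
    refine ⟨fun h0 x t ht => sub_nonneg.1 (pair_sub_nonneg hα hα' hθ hu hv hsub hsup hK0 hK hR h0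
      x t ⟨ht.1.le, ht.2⟩), fun h0 ⟨c, hc⟩ x t ht => ?_⟩
    have hw := pair_isNonnegSupersolution hα hα' hθ hu hv hsub hsup hK0 hK hR h0
    refine sub_pos.1 (lt_of_lt_of_le (mul_pos (Real.exp_pos _) ?_)
      -- The unit interval starts at a point `c` where the initial values differ, so continuity
      -- makes the integral positive.
      (hw.kernel_integral_le hα hα' hθ ha hD hK0 c x ht))
    have hpos := fun y => stableKernel_pos hα hα' hθ ha ha2 hD (x - y) ht.1
    refine intervalIntegral.integral_pos (by linarith)
      ((continuous_kernel_slice hα ha x ht.1).mul (hw.continuous_initial hT.le)).continuousOn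
      (fun y _ => mul_nonneg (hpos y).le (sub_nonneg.2 (h0 y)))
      ⟨c, ⟨le_rfl, by linarith⟩, mul_pos (hpos c) (sub_pos.2 (lt_of_le_of_ne (h0 c) hc))⟩
  · obtain ⟨K, hK0, hK⟩ := exists_lipschitz_const hf R
    -- `K` depends only on `f` and `R`. The minimum over `[-m-1, m+1]` suffices since `|x - y| ≤ |x|
    -- + 1` for `y ∈ [0, 1]`.
    refine ⟨fun m t => Real.exp (-K * t) * kernelMin α a m t, ?_, fun m t _ ht =>
      mul_pos (Real.exp_pos _) (kernelMin_pos hα hα' hθ ha ha2 hD m ht), ?_⟩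
    · have h1 : Continuous fun p : ℝ × ℝ => Real.exp (-K * p.2) := by fun_prop
      exact h1.continuousOn.mul (continuousOn_kernelMin hα ha)
    · intro T u v hT hu hv hsub hsup hR h0 x t ht
      have hw := pair_isNonnegSupersolution hα hα' hθ hu hv hsub hsup hK0 hK hR h0
      refine le_trans ?_ (hw.kernel_integral_le hα hα' hθ ha hD hK0 0 x ⟨ht.1, ht.2.le⟩)
      rw [mul_assoc, zero_add]
      refine mul_le_mul_of_nonneg_left ?_ (Real.exp_pos _).le
      rw [← intervalIntegral.integral_const_mul]
      have hc := hw.continuous_initial hT.le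
      refine intervalIntegral.integral_mono_on zero_le_one
        ((continuous_const.mul hc).intervalIntegrable _ _)
        (((continuous_kernel_slice hα ha x ht.1).mul hc).intervalIntegrable _ _) fun y hy => ?_
      refine mul_le_mul_of_nonneg_right (kernelMin_le hα ha ?_ (abs_nonneg x) ht.1)
        (sub_nonneg.2 (h0 y))
      have := abs_sub x y
      rw [abs_of_nonneg hy.1] at this
      linarith [hy.2]
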